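/- Use the Fourier transform $\widehat f(\xi)=\int_{\mathbb R} f(x)e^{-2\pi i x\xi}\,dx$, and let $H^1$ be the $L^2$-based Sobolev space of order one on the real line, i.e. the space of $f\in L^2(\mathbb R)$ with $\int_{\mathbb R}|\widehat f(\xi)|^2(1+|\xi|^2)\,d\xi<\infty$; let $\mathcal F(H^1)$ be the space of $f \in L^2(\mathbb R)$ whose inverse Fourier transform lies in $H^1$. Functions in $H^1\cap\mathcal F(H^1)$ are identified with their continuous representatives (they are integrable, so $\widehat f$ is a continuous function as well). For every $a>0$ and every $\theta<\tfrac12$ there is a constant $c>0$, depending only on $a$ and $\theta$, such that the following holds. Let $\Lambda=\{\lambda_i\}_{i\in\mathbb Z}$ and $\Gamma=\{\gamma_i\}_{i\in\mathbb Z}$ be real sequences with $\lambda_i\to\pm\infty$ and $\gamma_i\to\pm\infty$ as $i\to\pm\infty$, and $$\max\Big(\limsup_{i\to\pm\infty}|\lambda_{i+1}-\lambda_i|\,|\lambda_i|,\ \limsup_{i\to\pm\infty}|\gamma_{i+1}-\gamma_i|\,|\gamma_i|\Big)\le\theta .$$ Let $f\in H^1\cap\mathcal F(H^1)$, and suppose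 that for some constant $C$ $$|f(\lambda)|\le C e^{-a|\lambda|^2}\ \text{ for all }\lambda\in\Lambda,\qquad |\widehat f(\gamma)|\le C e^{-a|\gamma|^2}\ \text{ for all }\gamma\in\Gamma .$$ Then there is a constant $C'$ such that $$|f(x)|+|\widehat f(x)|\le C' e^{-c|x|^2}\qquad\text{for all }x\in\mathbb R .$$ (In particular, the conclusion holds whenever the maximum above is $<\tfrac12$.) -/

import Mathlib

open Filter MeasureTheory FourierTransform
open scoped SchwartzMap ENNReal

/-- `f` belongs to the Sobolev space `H¹` on the real line: `f` is square integrable, and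
`(1 + |ξ|²)^{1/2}` times the Fourier transform of `f` (taken in the sense of tempered
distributions) is square integrable. -/
def MemH1 (f : ℝ → ℂ) : Prop :=
  ∃ hf : MemLp f 2 (volume : Measure ℝ),
    TemperedDistribution.MemSobolev 1 2
      ((hf.toLp f : Lp ℂ 2 (volume : Measure ℝ)) : 𝓢'(ℝ, ℂ))

/-- `f` belongs to the Fourier image of `H¹`: `f` is square integrable and its inverse Fourier
transform (taken in `L²`) belongs to `H¹`. -/
def MemFourierH1 (f : ℝ → ℂ) : Prop :=
  ∃ hf : MemLp f 2 (volume : Measure ℝ),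
    TemperedDistribution.MemSobolev 1 2
      ((𝓕⁻ (hf.toLp f : Lp ℂ 2 (volume : Measure ℝ)) : Lp ℂ 2 (volume : Measure ℝ)) : 𝓢'(ℝ, ℂ))

/-- `limsup_{i → ±∞} |s (i + 1) - s i| * |s i|`, as an extended real number. -/
noncomputable def gapLimsup (s : ℤ → ℝ) : EReal :=
  limsup (fun i : ℤ => ((|s (i + 1) - s i| * |s i| : ℝ) : EReal)) (atBot ⊔ atTop)

/-!
Why the decay holds. Let `V f (x, ξ)` be the Fourier transform at `ξ` of the windowed function
`y ↦ f y * exp (-π (y - x)²)`, and let `m` be the Gaussian weight `exp (c x²)` cut off at a finite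
height. Three energies are compared:

* the position energy `∫∫ x² m(x) |V f|²` (`posEnergy`),
* the frequency energy `∫∫ ξ² m(x) |V f|²` (`freqEnergy`),
* the local energy `∫ m(x) ∫ y² |f y|² exp (-2π (y - x)²) dy dx` (`localEnergy`).

Consecutive sampling points near `y` are at distance at most about `θ / |y|`. If a function is
small at these points, Wirtinger's inequality on the intervals between them bounds `∫ y² |h|²` by
`ρ² ∫ ξ² |ĥ|²` up to a bounded error, for any `ρ > 2θ` (`wirtinger_of_continuous`). Applied to the
windowed functions, this bounds the local energy by `ρ²` times the frequency energy
(`localEnergy_le_of_gapLimsup`); the Gaussian decay along the samples makes the boundary terms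
summable against the weight if `c` is small.

The Gaussian is its own Fourier transform, so `|V f (x, ξ)| = |V f̂ (ξ, -x)|` (`enorm_stft_eq`).
As `(x² - ξ²) (m(x) - m(ξ)) ≥ 0`, the frequency energies of `f` and `f̂` add up to at most the sum
of their position energies (`freqEnergy_add_le`). Finally the position energy is at most
`(1 + η)²` times the local energy plus a constant, for any `η > 0`, if `c` is small enough
(`posEnergy_le`).

Since `2θ < 1`, one can have `ρ (1 + η) < 1`, and the three comparisons bound all energies
uniformly in the height of the cutoff (`exists_gaussian_bound`). A Sobolev bound for the windowed
functions turns this into pointwise decay (`weight_mul_le`).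
-/

/-! ### Plancherel's theorem and Sobolev functions -/

/-- The multiplication formula `∫ k̂ f = ∫ k f̂`. -/
theorem integral_fourier_mul_eq {f k : ℝ → ℂ} (hf : Integrable f) (hk : Integrable k) :
    ∫ y, 𝓕 k y * f y = ∫ η, k η * 𝓕 f η := by
  have := VectorFourier.integral_fourierIntegral_smul_eq_flip (L := innerₗ ℝ)
    (μ := volume) (ν := volume) (e := Real.fourierChar) Real.continuous_fourierChar
    (by exact continuous_inner) hk hf
  rw [flip_innerₗ] at this
  exact this

theorem eq_of_toTemperedDistribution_eq {u v : Lp ℂ 2 (volume : Measure ℝ)}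
    (h : (u : 𝓢'(ℝ, ℂ)) = (v : 𝓢'(ℝ, ℂ))) : u = v := by
  have hk := Lp.ker_toTemperedDistributionCLM_eq_bot (E := ℝ) (F := ℂ) (μ := volume) (p := 2)
  exact LinearMap.ker_eq_bot.mp hk h

/-- On integrable, square integrable functions the `L²` Fourier transform is represented by the
Fourier integral: the two agree as tempered distributions. -/
theorem fourier_toLp_ae_eq {f : ℝ → ℂ} (hf : Integrable f) (hf2 : MemLp f 2 volume) :
    ((𝓕 (hf2.toLp f) : Lp ℂ 2 (volume : Measure ℝ)) : ℝ → ℂ) =ᵐ[volume] 𝓕 f := by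
  have hc : Continuous (𝓕 f) :=
    VectorFourier.fourierIntegral_continuous Real.continuous_fourierChar
      (by exact continuous_inner) hf
  apply ae_eq_of_integral_contDiff_smul_eq
  · exact (Lp.memLp _).locallyIntegrable (by norm_num)
  · exact hc.locallyIntegrable
  · intro g g_smooth g_cpt
    have hg₁ : HasCompactSupport (Complex.ofRealCLM ∘ g) := g_cpt.comp_left rfl
    have hg₂ : ContDiff ℝ (⊤ : ℕ∞) (Complex.ofRealCLM ∘ g) := by fun_prop
    set φ : 𝓢(ℝ, ℂ) := hg₁.toSchwartzMap hg₂ with hφ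
    have h1 : ((𝓕 (hf2.toLp f) : Lp ℂ 2 (volume : Measure ℝ)) : 𝓢'(ℝ, ℂ)) φ
        = (hf2.toLp f : 𝓢'(ℝ, ℂ)) (𝓕 φ) := by
      rw [← Lp.fourier_toTemperedDistribution_eq]; rfl
    rw [Lp.toTemperedDistribution_apply, Lp.toTemperedDistribution_apply] at h1
    have h2 : ∫ x, (𝓕 φ : 𝓢(ℝ, ℂ)) x • (hf2.toLp f) x = ∫ x, 𝓕 (φ : ℝ → ℂ) x * f x := by
      apply integral_congr_ae
      filter_upwards [hf2.coeFn_toLp] with x hx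
      rw [hx, SchwartzMap.fourier_coe, smul_eq_mul]
    rw [h2, integral_fourier_mul_eq hf φ.integrable] at h1
    simpa [hφ] using h1

theorem memLp_two_iff {u : ℝ → ℂ} (hu : AEStronglyMeasurable u volume) :
    MemLp u 2 volume ↔ ∫⁻ x, ‖u x‖ₑ ^ 2 ≠ ∞ := by
  have h : MemLp u 2 volume ↔ eLpNorm u 2 volume < ∞ := ⟨fun h ↦ h.2, fun h ↦ ⟨hu, h⟩⟩
  rw [h, eLpNorm_lt_top_iff_lintegral_rpow_enorm_lt_top (by norm_num) (by norm_num)]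
  simp [lt_top_iff_ne_top]

/-- Plancherel's theorem for integrable, square integrable functions. -/
theorem lintegral_fourier_sq {f : ℝ → ℂ} (hf : Integrable f) (hf2 : MemLp f 2 volume) :
    ∫⁻ ξ, ‖𝓕 f ξ‖ₑ ^ 2 = ∫⁻ y, ‖f y‖ₑ ^ 2 := by
  have key : ∀ u : ℝ → ℂ, eLpNorm u 2 volume ^ 2 = ∫⁻ x, ‖u x‖ₑ ^ 2 := by
    intro u
    have := eLpNorm_nnreal_pow_eq_lintegral (f := u) (p := 2) (μ := volume) (by norm_num)
    simpa using this
  rw [← key, ← key]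
  congr 1
  rw [← eLpNorm_congr_ae (fourier_toLp_ae_eq hf hf2), ← eLpNorm_congr_ae hf2.coeFn_toLp]
  have := Lp.norm_fourier_eq (hf2.toLp f)
  rw [Lp.norm_def, Lp.norm_def] at this
  exact (ENNReal.toReal_eq_toReal_iff' (Lp.memLp _).eLpNorm_ne_top
    (Lp.memLp _).eLpNorm_ne_top).mp this

/-- If the distribution `(1 + |x|²)^{1/2} u` is an `L²` function `v`, then `u = (1 + |x|²)^{-1/2} v`
almost everywhere, so the weighted `L²` norm of `u` is finite. -/
theorem lintegral_of_smulLeftCLM {u v : Lp ℂ 2 (volume : Measure ℝ)}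
    (h : TemperedDistribution.smulLeftCLM ℂ
      (fun x : ℝ ↦ (((1 + ‖x‖ ^ 2) ^ ((1 : ℝ) / 2) : ℝ) : ℂ)) (u : 𝓢'(ℝ, ℂ)) = (v : 𝓢'(ℝ, ℂ))) :
    ∫⁻ x, ENNReal.ofReal (1 + x ^ 2) * ‖u x‖ₑ ^ 2 ≠ ∞ := by
  set w : ℝ → ℂ := fun x ↦ (((1 + ‖x‖ ^ 2) ^ (-(1 : ℝ) / 2) : ℝ) : ℂ) with hw
  have hwc : Continuous w := by
    have : w.HasTemperateGrowth := by fun_prop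
    exact this.1.continuous
  have hw2 : MemLp w ∞ volume := by
    refine memLp_top_of_bound hwc.aestronglyMeasurable 1 (Eventually.of_forall fun x ↦ ?_)
    rw [hw, Complex.norm_real, Real.norm_eq_abs, abs_of_nonneg (by positivity)]
    exact Real.rpow_le_one_of_one_le_of_nonpos (by nlinarith [sq_nonneg ‖x‖]) (by norm_num)
  have hu : u = (hw2.toLp w) • v := by
    apply eq_of_toTemperedDistribution_eq
    rw [Lp.toTemperedDistribution_smul_eq (by fun_prop), ← h,
      TemperedDistribution.smulLeftCLM_smulLeftCLM_apply (by fun_prop) (by fun_prop)]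
    have : ((fun x : ℝ ↦ (((1 + ‖x‖ ^ 2) ^ ((1 : ℝ) / 2) : ℝ) : ℂ)) * w) = fun _ ↦ 1 := by
      ext x
      simp only [hw, Pi.mul_apply]
      rw [← Complex.ofReal_mul, ← Real.rpow_add (by positivity)]
      norm_num
    rw [this]; simp
  have hae : ∀ᵐ x, ENNReal.ofReal (1 + x ^ 2) * ‖u x‖ₑ ^ 2 = ‖v x‖ₑ ^ 2 := by
    have h3 := Lp.coeFn_lpSMul (r := 2) (hw2.toLp w) v
    rw [← hu] at h3
    filter_upwards [h3, hw2.coeFn_toLp] with x hx hx'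
    rw [hx, Pi.smul_apply', hx', smul_eq_mul, enorm_mul, mul_pow, ← mul_assoc]
    have : ENNReal.ofReal (1 + x ^ 2) * ‖w x‖ₑ ^ 2 = 1 := by
      rw [← ofReal_norm, ← ENNReal.ofReal_pow (norm_nonneg _), ← ENNReal.ofReal_mul (by positivity)]
      have hs : ((1 + ‖x‖ ^ 2) ^ (-(1 : ℝ) / 2)) ^ 2 = (1 + x ^ 2)⁻¹ := by
        rw [← Real.rpow_natCast, ← Real.rpow_mul (by positivity), Real.norm_eq_abs, sq_abs]
        norm_num [Real.rpow_neg_one]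
      rw [hw, Complex.norm_real, Real.norm_eq_abs, abs_of_nonneg (by positivity), hs,
        mul_inv_cancel₀ (by positivity), ENNReal.ofReal_one]
    rw [this, one_mul]
  rw [lintegral_congr_ae hae]
  exact (memLp_two_iff (Lp.aestronglyMeasurable v)).mp (Lp.memLp v)

theorem MemFourierH1.lintegral_ne_top {f : ℝ → ℂ} (h : MemFourierH1 f) :
    ∫⁻ x, ENNReal.ofReal (1 + x ^ 2) * ‖f x‖ₑ ^ 2 ≠ ∞ := by
  obtain ⟨hf, h⟩ := h
  obtain ⟨v, hv⟩ := TemperedDistribution.memSobolev_iff_exists_smulLeftCLM_fourier.mp h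
  rw [Lp.fourier_toTemperedDistribution_eq, fourier_fourierInv_eq] at hv
  have := lintegral_of_smulLeftCLM hv
  rwa [lintegral_congr_ae (g := fun x ↦ ENNReal.ofReal (1 + x ^ 2) * ‖f x‖ₑ ^ 2)] at this
  filter_upwards [hf.coeFn_toLp] with x hx
  rw [hx]

theorem MemH1.lintegral_fourier_ne_top {f : ℝ → ℂ} (h : MemH1 f) (hi : Integrable f) :
    ∫⁻ ξ, ENNReal.ofReal (1 + ξ ^ 2) * ‖𝓕 f ξ‖ₑ ^ 2 ≠ ∞ := by
  obtain ⟨hf, h⟩ := h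
  obtain ⟨v, hv⟩ := TemperedDistribution.memSobolev_iff_exists_smulLeftCLM_fourier.mp h
  rw [Lp.fourier_toTemperedDistribution_eq] at hv
  have := lintegral_of_smulLeftCLM hv
  rwa [lintegral_congr_ae (g := fun x ↦ ENNReal.ofReal (1 + x ^ 2) * ‖𝓕 f x‖ₑ ^ 2)] at this
  filter_upwards [fourier_toLp_ae_eq hi hf] with x hx
  rw [hx]

/-- Cauchy–Schwarz with the weight `1 + x²`. -/
theorem lintegral_enorm_sq_le (u : ℝ → ℂ) (hu : AEMeasurable u) :
    (∫⁻ x, ‖u x‖ₑ) ^ 2 ≤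
      ENNReal.ofReal Real.pi * ∫⁻ x, ENNReal.ofReal (1 + x ^ 2) * ‖u x‖ₑ ^ 2 := by
  have hpos : ∀ x : ℝ, 0 < 1 + x ^ 2 := fun x ↦ by positivity
  have hm : Measurable fun x : ℝ ↦ ENNReal.ofReal (Real.sqrt (1 + x ^ 2)) := by fun_prop
  have hm' : Measurable fun x : ℝ ↦ ENNReal.ofReal (Real.sqrt (1 + x ^ 2))⁻¹ := by fun_prop
  have h := ENNReal.lintegral_mul_le_Lp_mul_Lq volume Real.HolderConjugate.two_two
    (f := fun x : ℝ ↦ ENNReal.ofReal (Real.sqrt (1 + x ^ 2))⁻¹)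
    (g := fun x : ℝ ↦ ENNReal.ofReal (Real.sqrt (1 + x ^ 2)) * ‖u x‖ₑ)
    hm'.aemeasurable (hm.aemeasurable.mul hu.enorm)
  have e1 : ∀ x : ℝ, (ENNReal.ofReal (Real.sqrt (1 + x ^ 2))⁻¹) ^ (2 : ℝ)
      = ENNReal.ofReal (1 + x ^ 2)⁻¹ := by
    intro x
    rw [ENNReal.rpow_two, ← ENNReal.ofReal_pow (by positivity), inv_pow, Real.sq_sqrt (hpos x).le]
  have e2 : ∀ x : ℝ, (ENNReal.ofReal (Real.sqrt (1 + x ^ 2)) * ‖u x‖ₑ) ^ (2 : ℝ)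
      = ENNReal.ofReal (1 + x ^ 2) * ‖u x‖ₑ ^ 2 := by
    intro x
    rw [ENNReal.rpow_two, mul_pow, ← ENNReal.ofReal_pow (by positivity), Real.sq_sqrt (hpos x).le]
  have e3 : ∀ x : ℝ, ENNReal.ofReal (Real.sqrt (1 + x ^ 2))⁻¹ *
      (ENNReal.ofReal (Real.sqrt (1 + x ^ 2)) * ‖u x‖ₑ) = ‖u x‖ₑ := by
    intro x
    rw [← mul_assoc, ← ENNReal.ofReal_mul (by positivity),
      inv_mul_cancel₀ (Real.sqrt_pos.mpr (hpos x)).ne']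
    simp
  have e4 : ∫⁻ x : ℝ, ENNReal.ofReal (1 + x ^ 2)⁻¹ = ENNReal.ofReal Real.pi := by
    rw [← ofReal_integral_eq_lintegral_ofReal integrable_inv_one_add_sq
      (Eventually.of_forall fun x ↦ by positivity), integral_univ_inv_one_add_sq]
  simp only [Pi.mul_apply, e1, e2, e3, e4] at h
  calc _ ≤ (_ * _) ^ 2 := by gcongr
    _ = _ := by
      rw [mul_pow, ← ENNReal.rpow_natCast, ← ENNReal.rpow_natCast, ← ENNReal.rpow_mul,
        ← ENNReal.rpow_mul]
      norm_num

theorem integrable_of_lintegral_weight {u : ℝ → ℂ} (hu : AEStronglyMeasurable u volume)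
    (h : ∫⁻ x, ENNReal.ofReal (1 + x ^ 2) * ‖u x‖ₑ ^ 2 ≠ ∞) : Integrable u := by
  refine ⟨hu, ?_⟩
  have h1 := lintegral_enorm_sq_le u hu.aemeasurable
  have h2 : (∫⁻ x, ‖u x‖ₑ) ^ 2 < ∞ :=
    h1.trans_lt (ENNReal.mul_lt_top ENNReal.ofReal_lt_top h.lt_top)
  rw [HasFiniteIntegral]
  simpa using h2

/-! ### Wirtinger's inequality with boundary terms -/

/-- Wirtinger's inequality without boundary conditions: integrate
`‖h' + κ tan (κ (y - m)) h‖² ≥ 0` over `[a, b]`, where `m` is the midpoint. -/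
theorem intervalIntegral_wirtinger {h h' : ℝ → ℂ} (hd : ∀ y, HasDerivAt h (h' y) y)
    (hc : Continuous h') {a b κ : ℝ} (hab : a ≤ b) (hκ : 0 < κ) (hκb : κ * (b - a) < Real.pi) :
    κ ^ 2 * ∫ y in a..b, ‖h y‖ ^ 2 ≤
      (∫ y in a..b, ‖h' y‖ ^ 2) +
        κ * Real.tan (κ * (b - a) / 2) * (‖h a‖ ^ 2 + ‖h b‖ ^ 2) := by
  have hh : Continuous h := continuous_iff_continuousAt.mpr fun y ↦ (hd y).continuousAt
  set m : ℝ := (a + b) / 2 with hm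
  set t : ℝ → ℝ := fun y ↦ Real.tan (κ * (y - m)) with ht
  have hcos : ∀ y ∈ Set.uIcc a b, Real.cos (κ * (y - m)) ≠ 0 := by
    intro y hy
    rw [Set.uIcc_of_le hab] at hy
    refine (Real.cos_pos_of_mem_Ioo ⟨?_, ?_⟩).ne' <;> nlinarith [hy.1, hy.2]
  set F' : ℝ → ℝ := fun y ↦ κ ^ 2 * (1 + t y ^ 2) * ‖h y‖ ^ 2
    + κ * t y * (2 * inner ℝ (h y) (h' y)) with hF'
  have hder : ∀ y ∈ Set.uIcc a b, HasDerivAt (fun y ↦ κ * t y * ‖h y‖ ^ 2) (F' y) y := by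
    intro y hy
    have h1 : HasDerivAt (fun y ↦ κ * (y - m)) κ y := by
      simpa using ((hasDerivAt_id y).sub_const m).const_mul κ
    have h2 := ((Real.hasDerivAt_tan (hcos y hy)).comp y h1).const_mul κ
    have h3 := h2.mul (hd y).norm_sq
    refine h3.congr_deriv ?_
    have h4 : 1 / Real.cos (κ * (y - m)) ^ 2 = 1 + t y ^ 2 := by
      have := hcos y hy
      rw [ht]
      simp only [Real.tan_eq_sin_div_cos]
      field_simp
      nlinarith [Real.sin_sq_add_cos_sq (κ * (y - m))]
    rw [hF', h4]
    simp only [Function.comp, ht]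
    ring
  have htc : ContinuousOn t (Set.uIcc a b) := by
    intro y hy
    have h1 : ContinuousAt (fun y ↦ κ * (y - m)) y := by fun_prop
    exact (ContinuousAt.comp (f := fun y ↦ κ * (y - m)) (g := Real.tan)
      (Real.continuousAt_tan.mpr (hcos y hy)) h1).continuousWithinAt
  have hFc : ContinuousOn F' (Set.uIcc a b) := by
    have : Continuous fun y ↦ (inner ℝ (h y) (h' y) : ℝ) := hh.inner hc
    rw [hF']
    fun_prop
  have hint := intervalIntegral.integral_eq_sub_of_hasDerivAt hder hFc.intervalIntegrable
  have hi1 : IntervalIntegrable (fun y ↦ ‖h' y‖ ^ 2) volume a b :=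
    Continuous.intervalIntegrable (by fun_prop) _ _
  have hmono : ∫ y in a..b, κ ^ 2 * ‖h y‖ ^ 2 ≤ ∫ y in a..b, (‖h' y‖ ^ 2 + F' y) := by
    refine intervalIntegral.integral_mono_on hab ?_ ?_ fun y _ ↦ ?_
    · exact Continuous.intervalIntegrable (by fun_prop) _ _
    · exact hi1.add hFc.intervalIntegrable
    · -- the difference of the two sides is `‖h' + κ tan(κ (y - m)) h‖²`
      have h5 := norm_add_sq_real (h' y) ((κ * t y) • h y)
      have h6 : ‖(κ * t y) • h y‖ ^ 2 = (κ * t y) ^ 2 * ‖h y‖ ^ 2 := by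
        rw [norm_smul, mul_pow, Real.norm_eq_abs, sq_abs]
      rw [h6, inner_smul_right, real_inner_comm (h y) (h' y)] at h5
      have h7 := sq_nonneg ‖h' y + (κ * t y) • h y‖
      rw [h5] at h7
      simp only [hF']
      linarith
  have hadd := intervalIntegral.integral_add hi1 hFc.intervalIntegrable
  rw [intervalIntegral.integral_const_mul, hadd, hint] at hmono
  have hbm : κ * (b - m) = κ * (b - a) / 2 := by simp only [hm]; ring
  have ham : κ * (a - m) = -(κ * (b - a) / 2) := by simp only [hm]; ring
  have e1 : t b = Real.tan (κ * (b - a) / 2) := by simp only [ht, hbm]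
  have e2 : t a = -Real.tan (κ * (b - a) / 2) := by simp only [ht, ham, Real.tan_neg]
  rw [e1, e2] at hmono
  linarith

theorem ofReal_intervalIntegral_norm_sq {h : ℝ → ℂ} (hc : Continuous h) {a b : ℝ} (hab : a ≤ b) :
    ENNReal.ofReal (∫ y in a..b, ‖h y‖ ^ 2) = ∫⁻ y in Set.Ioc a b, ‖h y‖ₑ ^ 2 := by
  rw [intervalIntegral.integral_of_le hab, ofReal_integral_eq_lintegral_ofReal]
  · refine lintegral_congr fun y ↦ ?_
    rw [ENNReal.ofReal_pow (norm_nonneg _), ofReal_norm]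
  · exact (Continuous.integrableOn_Icc (by fun_prop)).mono_set Set.Ioc_subset_Icc_self
  · exact Eventually.of_forall fun y ↦ by positivity

/-- An increasing sequence of positive points `p n` with `2 p (n + 1) (p (n + 1) - p n) ≤ ρ`. This
is an asymmetric form of `p (n + 1) ^ 2 - p n ^ 2 ≤ ρ`, with the larger endpoint as the factor
because the weight `y ^ 2` is largest there. -/
structure IsSquareChain (ρ : ℝ) (p : ℕ → ℝ) : Prop where
  pos : ∀ n, 0 < p n
  lt_succ : ∀ n, p n < p (n + 1)
  step : ∀ n, 2 * p (n + 1) * (p (n + 1) - p n) ≤ ρ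

/-- The constant `ρ / (2π) · tan (π ρ₂ / (2ρ))` in front of the boundary terms; it is finite because
`ρ₂ < ρ` keeps the argument of the tangent below `π / 2`. -/
noncomputable def bdryConst (ρ₂ ρ : ℝ) : ℝ :=
  ρ / (2 * Real.pi) * Real.tan (Real.pi * ρ₂ / ρ / 2)

/-- Wirtinger's inequality on one interval of a chain, with `κ = 2π p (n + 1) / ρ`. -/
theorem wirtinger_step {h h' : ℝ → ℂ} (hd : ∀ y, HasDerivAt h (h' y) y) (hc : Continuous h')
    {ρ₂ ρ : ℝ} (h0 : 0 < ρ₂) (hρ : ρ₂ < ρ) {p : ℕ → ℝ} (hp : IsSquareChain ρ₂ p) (n : ℕ) :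
    ∫⁻ y in Set.Ioc (p n) (p (n + 1)), ENNReal.ofReal (y ^ 2) * ‖h y‖ₑ ^ 2 ≤
      ENNReal.ofReal (ρ ^ 2 / (4 * Real.pi ^ 2)) * (∫⁻ y in Set.Ioc (p n) (p (n + 1)), ‖h' y‖ₑ ^ 2)
      + ENNReal.ofReal (bdryConst ρ₂ ρ * p (n + 1)) * (‖h (p n)‖ₑ ^ 2 + ‖h (p (n + 1))‖ₑ ^ 2) := by
  have hh : Continuous h := continuous_iff_continuousAt.mpr fun y ↦ (hd y).continuousAt
  have hρ0 : 0 < ρ := h0.trans hρ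
  set P := p (n + 1) with hP
  have hP0 : 0 < P := hp.pos _
  have hlt := (hp.lt_succ n).le
  set κ : ℝ := 2 * Real.pi * P / ρ with hκ
  have hκ0 : 0 < κ := by positivity
  have hκL : κ * (P - p n) ≤ Real.pi * ρ₂ / ρ := by
    have h1 := hp.step n
    have h2 : κ * (P - p n) = Real.pi * (2 * P * (P - p n)) / ρ := by rw [hκ]; ring
    rw [h2]; gcongr
  have hσ : Real.pi * ρ₂ / ρ < Real.pi := by
    rw [div_lt_iff₀ hρ0]; gcongr
  have hL0 : 0 ≤ κ * (P - p n) := mul_nonneg hκ0.le (by linarith)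
  have hw := intervalIntegral_wirtinger hd hc hlt hκ0 (hκL.trans_lt hσ)
  have htan : Real.tan (κ * (P - p n) / 2) ≤ Real.tan (Real.pi * ρ₂ / ρ / 2) := by
    rcases hκL.eq_or_lt with h | h
    · rw [h]
    · exact (Real.tan_lt_tan_of_lt_of_lt_pi_div_two (by linarith) (by linarith) (by linarith)).le
  have hkey : P ^ 2 * ∫ y in p n..P, ‖h y‖ ^ 2 ≤ ρ ^ 2 / (4 * Real.pi ^ 2) *
      (∫ y in p n..P, ‖h' y‖ ^ 2) + bdryConst ρ₂ ρ * P * (‖h (p n)‖ ^ 2 + ‖h P‖ ^ 2) := by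
    have h1 : κ * Real.tan (κ * (P - p n) / 2) * (‖h (p n)‖ ^ 2 + ‖h P‖ ^ 2) ≤
        κ * Real.tan (Real.pi * ρ₂ / ρ / 2) * (‖h (p n)‖ ^ 2 + ‖h P‖ ^ 2) := by gcongr
    have h2 := mul_le_mul_of_nonneg_left (hw.trans (add_le_add_right h1 _))
      (by positivity : 0 ≤ ρ ^ 2 / (4 * Real.pi ^ 2))
    have e1 : P ^ 2 = ρ ^ 2 / (4 * Real.pi ^ 2) * κ ^ 2 := by
      simp only [hκ]; field_simp; ring
    have e2 : bdryConst ρ₂ ρ * P = ρ ^ 2 / (4 * Real.pi ^ 2) *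
        (κ * Real.tan (Real.pi * ρ₂ / ρ / 2)) := by
      simp only [hκ, bdryConst]; field_simp; ring
    rw [e1, e2]
    linarith
  have htan0 : 0 ≤ Real.tan (Real.pi * ρ₂ / ρ / 2) :=
    Real.tan_nonneg_of_nonneg_of_le_pi_div_two (by positivity) (by linarith)
  have hK : 0 ≤ bdryConst ρ₂ ρ * P := by unfold bdryConst; positivity
  have hsq : ∀ z : ℂ, ENNReal.ofReal (‖z‖ ^ 2) = ‖z‖ₑ ^ 2 := fun z ↦ by
    rw [ENNReal.ofReal_pow (norm_nonneg _), ofReal_norm]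
  have hI : ∀ k : ℝ → ℂ, 0 ≤ ∫ y in p n..P, ‖k y‖ ^ 2 := fun k ↦
    intervalIntegral.integral_nonneg hlt fun y _ ↦ by positivity
  have hfin := ENNReal.ofReal_le_ofReal hkey
  rw [ENNReal.ofReal_add (mul_nonneg (by positivity) (hI _)) (mul_nonneg hK (by positivity)),
    ENNReal.ofReal_mul (by positivity), ENNReal.ofReal_mul (by positivity),
    ENNReal.ofReal_mul hK, ofReal_intervalIntegral_norm_sq hh hlt,
    ofReal_intervalIntegral_norm_sq hc hlt, ENNReal.ofReal_add (by positivity) (by positivity),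
    hsq, hsq] at hfin
  refine le_trans ?_ hfin
  rw [← lintegral_const_mul' _ _ ENNReal.ofReal_ne_top]
  refine setLIntegral_mono' measurableSet_Ioc fun y hy ↦ ?_
  gcongr
  · exact ((hp.pos n).trans hy.1).le
  · exact hy.2

theorem wirtinger_finite {h h' : ℝ → ℂ} (hd : ∀ y, HasDerivAt h (h' y) y) (hc : Continuous h')
    {ρ₂ ρ : ℝ} (h0 : 0 < ρ₂) (hρ : ρ₂ < ρ) {p : ℕ → ℝ} (hp : IsSquareChain ρ₂ p) (N : ℕ) :
    ∫⁻ y in Set.Ioc (p 0) (p N), ENNReal.ofReal (y ^ 2) * ‖h y‖ₑ ^ 2 ≤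
      ENNReal.ofReal (ρ ^ 2 / (4 * Real.pi ^ 2)) * (∫⁻ y in Set.Ioc (p 0) (p N), ‖h' y‖ₑ ^ 2)
      + ∑ n ∈ Finset.range N, ENNReal.ofReal (bdryConst ρ₂ ρ * p (n + 1)) *
        (‖h (p n)‖ₑ ^ 2 + ‖h (p (n + 1))‖ₑ ^ 2) := by
  have hmono : Monotone p := monotone_nat_of_le_succ fun n ↦ (hp.lt_succ n).le
  induction N with
  | zero => simp
  | succ N ih =>
    have hdisj : Disjoint (Set.Ioc (p 0) (p N)) (Set.Ioc (p N) (p (N + 1))) :=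
      Set.Ioc_disjoint_Ioc_of_le le_rfl
    rw [← Set.Ioc_union_Ioc_eq_Ioc (hmono (Nat.zero_le N)) (hp.lt_succ N).le,
      lintegral_union measurableSet_Ioc hdisj, lintegral_union measurableSet_Ioc hdisj,
      Finset.sum_range_succ, mul_add]
    calc _ ≤ _ := add_le_add ih (wirtinger_step hd hc h0 hρ hp N)
      _ = _ := by ring

theorem lintegral_Ioi_add_neg (F : ℝ → ℝ≥0∞) :
    (∫⁻ y in Set.Ioi 0, F y) + ∫⁻ y in Set.Ioi 0, F (-y) = ∫⁻ y, F y := by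
  have h1 : ∫⁻ y in Set.Ioi (0 : ℝ), F (-y) = ∫⁻ y in Set.Iio (0 : ℝ), F y := by
    have := (Measure.measurePreserving_neg (volume : Measure ℝ)).setLIntegral_comp_preimage_emb
      (MeasurableEquiv.neg ℝ).measurableEmbedding F (Set.Iio 0)
    simpa using this
  rw [h1, add_comm, setLIntegral_congr (Ioi_ae_eq_Ici (a := (0 : ℝ))),
    ← Set.compl_Iio, lintegral_add_compl F measurableSet_Iio]

/-- The boundary term that the `n`-th interval of the chain `p` contributes. -/
noncomputable def bdryTerm (ρ₂ ρ : ℝ) (p : ℕ → ℝ) (h : ℝ → ℂ) (n : ℕ) : ℝ≥0∞ :=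
  ENNReal.ofReal (bdryConst ρ₂ ρ * p (n + 1)) * (‖h (p n)‖ₑ ^ 2 + ‖h (p (n + 1))‖ₑ ^ 2)

theorem wirtinger_two_sided {h h' : ℝ → ℂ} (hd : ∀ y, HasDerivAt h (h' y) y) (hc : Continuous h')
    {ρ₂ ρ : ℝ} (h0 : 0 < ρ₂) (hρ : ρ₂ < ρ) {p q : ℕ → ℝ} (hp : IsSquareChain ρ₂ p)
    (hq : IsSquareChain ρ₂ q) (N : ℕ) :
    (∫⁻ y in Set.Ioc (p 0) (p N), ENNReal.ofReal (y ^ 2) * ‖h y‖ₑ ^ 2) +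
      (∫⁻ y in Set.Ioc (q 0) (q N), ENNReal.ofReal (y ^ 2) * ‖h (-y)‖ₑ ^ 2) ≤
      ENNReal.ofReal (ρ ^ 2 / (4 * Real.pi ^ 2)) * (∫⁻ y, ‖h' y‖ₑ ^ 2) +
      ((∑ n ∈ Finset.range N, bdryTerm ρ₂ ρ p h n) +
        ∑ n ∈ Finset.range N, bdryTerm ρ₂ ρ q (fun y ↦ h (-y)) n) := by
  have h1 := wirtinger_finite hd hc h0 hρ hp N
  have hd' : ∀ y, HasDerivAt (fun y ↦ h (-y)) (-h' (-y)) y := fun y ↦ by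
    have := (hd (-y)).scomp y (hasDerivAt_neg y)
    rw [neg_smul, one_smul] at this
    exact this
  have h2 := wirtinger_finite hd' (by fun_prop) h0 hρ hq N
  have hsub : ∀ r : ℕ → ℝ, IsSquareChain ρ₂ r → Set.Ioc (r 0) (r N) ⊆ Set.Ioi 0 :=
    fun r hr y hy ↦ (hr.pos 0).trans hy.1
  have h3 := lintegral_mono_set (μ := volume) (f := fun y ↦ ‖h' y‖ₑ ^ 2) (hsub p hp)
  have h4 := lintegral_mono_set (μ := volume) (f := fun y ↦ ‖h' (-y)‖ₑ ^ 2) (hsub q hq)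
  simp only [enorm_neg] at h2
  rw [← lintegral_Ioi_add_neg fun y ↦ ‖h' y‖ₑ ^ 2]
  simp only [bdryTerm]
  calc _ ≤ _ := add_le_add h1 h2
    _ ≤ _ := add_le_add (add_le_add_left (mul_le_mul_right h3 _) _)
      (add_le_add_left (mul_le_mul_right h4 _) _)
    _ = _ := by ring

/-! ### Wirtinger's inequality for Fourier transforms -/

theorem continuous_fourier_of_integrable {u : ℝ → ℂ} (hu : Integrable u) : Continuous (𝓕 u) :=
  VectorFourier.fourierIntegral_continuous Real.continuous_fourierChar
    (by exact continuous_inner) hu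

theorem enorm_fourier_le (u : ℝ → ℂ) (y : ℝ) : ‖𝓕 u y‖ₑ ≤ ∫⁻ ξ, ‖u ξ‖ₑ := by
  rw [Real.fourier_eq]
  refine (enorm_integral_le_lintegral_enorm _).trans (le_of_eq (lintegral_congr fun ξ ↦ ?_))
  rw [← ofReal_norm, ← ofReal_norm, Circle.norm_smul]

/-- Restriction of `u` to the band `[-k, k]`. -/
noncomputable def bandCut (u : ℝ → ℂ) (k : ℕ) : ℝ → ℂ := (Set.Icc (-(k : ℝ)) k).indicator u

theorem integrable_bandCut {u : ℝ → ℂ} (hu : Integrable u) (k : ℕ) : Integrable (bandCut u k) :=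
  hu.indicator measurableSet_Icc

theorem enorm_bandCut_le (u : ℝ → ℂ) (k : ℕ) (ξ : ℝ) : ‖bandCut u k ξ‖ₑ ≤ ‖u ξ‖ₑ :=
  enorm_indicator_le_enorm_self _ _

theorem integrable_mul_bandCut {u : ℝ → ℂ} (hu : Integrable u) (k : ℕ) :
    Integrable fun ξ : ℝ ↦ ξ • bandCut u k ξ := by
  have h1 : (fun ξ : ℝ ↦ ξ • bandCut u k ξ) =
      (Set.Icc (-(k : ℝ)) k).indicator (fun ξ ↦ ξ • u ξ) := by
    ext ξ
    simp only [bandCut, Set.indicator]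
    split_ifs <;> simp
  rw [h1, integrable_indicator_iff measurableSet_Icc]
  exact hu.integrableOn.continuousOn_smul continuousOn_id isCompact_Icc

theorem tendsto_fourier_bandCut {u : ℝ → ℂ} (hu : Integrable u) (y : ℝ) :
    Tendsto (fun k ↦ 𝓕 (bandCut u k) y) atTop (nhds (𝓕 u y)) := by
  simp only [Real.fourier_eq]
  refine tendsto_integral_of_dominated_convergence (fun ξ ↦ ‖u ξ‖) (fun k ↦ ?_) hu.norm
    (fun k ↦ Eventually.of_forall fun ξ ↦ ?_) (Eventually.of_forall fun ξ ↦ ?_)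
  · exact ((Real.fourierIntegral_convergent_iff y).2 (integrable_bandCut hu k)).1
  · rw [Circle.norm_smul]
    exact norm_indicator_le_norm_self _ _
  · refine tendsto_const_nhds.congr' ?_
    obtain ⟨n, hn⟩ := exists_nat_ge |ξ|
    filter_upwards [eventually_ge_atTop n] with k hk
    have : |ξ| ≤ k := hn.trans (by exact_mod_cast hk)
    rw [bandCut, Set.indicator_of_mem (by exact abs_le.mp this)]

theorem tendsto_setLIntegral_fourier_bandCut {u : ℝ → ℂ} (hu : Integrable u) (a b : ℝ)
    (s : ℝ → ℝ) (hs : Continuous s) :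
    Tendsto (fun k ↦ ∫⁻ y in Set.Ioc a b, ENNReal.ofReal (y ^ 2) * ‖𝓕 (bandCut u k) (s y)‖ₑ ^ 2)
      atTop (nhds (∫⁻ y in Set.Ioc a b, ENNReal.ofReal (y ^ 2) * ‖𝓕 u (s y)‖ₑ ^ 2)) := by
  have hfin : (∫⁻ ξ, ‖u ξ‖ₑ) ^ 2 ≠ ∞ := ENNReal.pow_ne_top hu.2.ne
  have hint : IntegrableOn (fun y : ℝ ↦ y ^ 2) (Set.Ioc a b) :=
    (Continuous.integrableOn_Icc (by fun_prop)).mono_set Set.Ioc_subset_Icc_self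
  refine tendsto_lintegral_of_dominated_convergence
    (fun y ↦ ENNReal.ofReal (y ^ 2) * (∫⁻ ξ, ‖u ξ‖ₑ) ^ 2) (fun k ↦ ?_)
    (fun k ↦ Eventually.of_forall fun y ↦ ?_) ?_ (Eventually.of_forall fun y ↦ ?_)
  · have := continuous_fourier_of_integrable (integrable_bandCut hu k)
    have : Continuous fun y ↦ 𝓕 (bandCut u k) (s y) := by fun_prop
    have := this.measurable
    fun_prop
  · dsimp only
    gcongr
    exact (enorm_fourier_le _ _).trans (lintegral_mono fun ξ ↦ enorm_bandCut_le u k ξ)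
  · rw [lintegral_mul_const' _ _ hfin]
    exact ENNReal.mul_ne_top hint.lintegral_lt_top.ne hfin
  · refine ENNReal.Tendsto.const_mul ?_ (Or.inr ENNReal.ofReal_ne_top)
    exact ((ENNReal.continuous_pow 2).tendsto _).comp (tendsto_fourier_bandCut hu _).enorm

/-- The two-sided inequality on finitely many intervals for `𝓕 u`. The functions
`𝓕 (bandCut u k)` are continuously differentiable and converge to `𝓕 u`. -/
theorem wirtinger_fourier_finite {u : ℝ → ℂ} (hu : Integrable u)
    (hB : ∫⁻ ξ, ENNReal.ofReal (ξ ^ 2) * ‖u ξ‖ₑ ^ 2 ≠ ∞)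
    {ρ₂ ρ : ℝ} (h0 : 0 < ρ₂) (hρ : ρ₂ < ρ) {p q : ℕ → ℝ} (hp : IsSquareChain ρ₂ p)
    (hq : IsSquareChain ρ₂ q) (N : ℕ) :
    (∫⁻ y in Set.Ioc (p 0) (p N), ENNReal.ofReal (y ^ 2) * ‖𝓕 u y‖ₑ ^ 2) +
      (∫⁻ y in Set.Ioc (q 0) (q N), ENNReal.ofReal (y ^ 2) * ‖𝓕 u (-y)‖ₑ ^ 2) ≤
      ENNReal.ofReal (ρ ^ 2) * (∫⁻ ξ, ENNReal.ofReal (ξ ^ 2) * ‖u ξ‖ₑ ^ 2) +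
      ((∑ n ∈ Finset.range N, bdryTerm ρ₂ ρ p (𝓕 u) n) +
        ∑ n ∈ Finset.range N, bdryTerm ρ₂ ρ q (fun y ↦ 𝓕 u (-y)) n) := by
  have hterm : ∀ (s : ℝ → ℝ) (r : ℕ → ℝ) (n : ℕ),
      Tendsto (fun k ↦ bdryTerm ρ₂ ρ r (fun y ↦ 𝓕 (bandCut u k) (s y)) n) atTop
        (nhds (bdryTerm ρ₂ ρ r (fun y ↦ 𝓕 u (s y)) n)) := by
    intro s r n
    refine ENNReal.Tendsto.const_mul ?_ (Or.inr ENNReal.ofReal_ne_top)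
    exact (((ENNReal.continuous_pow 2).tendsto _).comp (tendsto_fourier_bandCut hu _).enorm).add
      (((ENNReal.continuous_pow 2).tendsto _).comp (tendsto_fourier_bandCut hu _).enorm)
  refine le_of_tendsto_of_tendsto'
    ((tendsto_setLIntegral_fourier_bandCut hu (p 0) (p N) (fun y ↦ y) continuous_id).add
      (tendsto_setLIntegral_fourier_bandCut hu (q 0) (q N) (fun y ↦ -y) continuous_neg))
    (tendsto_const_nhds.add ((tendsto_finsetSum _ fun n _ ↦ hterm (fun y ↦ y) p n).add
      (tendsto_finsetSum _ fun n _ ↦ hterm (fun y ↦ -y) q n))) fun k ↦ ?_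
  set v : ℝ → ℂ := fun ξ ↦ (-2 * Real.pi * Complex.I * ξ) • bandCut u k ξ with hv
  have hvi : Integrable v := by
    have := (integrable_mul_bandCut hu k).const_mul (-2 * Real.pi * Complex.I)
    refine this.congr (Eventually.of_forall fun ξ ↦ ?_)
    simp only [hv, smul_eq_mul, Complex.real_smul]; ring
  have hder := Real.hasDerivAt_fourier (integrable_bandCut hu k) (integrable_mul_bandCut hu k)
  have hvle : ∫⁻ ξ, ‖v ξ‖ₑ ^ 2 ≤
      ENNReal.ofReal (4 * Real.pi ^ 2) * ∫⁻ ξ, ENNReal.ofReal (ξ ^ 2) * ‖u ξ‖ₑ ^ 2 := by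
    rw [← lintegral_const_mul' _ _ ENNReal.ofReal_ne_top]
    refine lintegral_mono fun ξ ↦ ?_
    have h1 : ‖(-2 * Real.pi * Complex.I * ξ : ℂ)‖ₑ ^ 2 =
        ENNReal.ofReal (4 * Real.pi ^ 2) * ENNReal.ofReal (ξ ^ 2) := by
      rw [← ofReal_norm, ← ENNReal.ofReal_pow (norm_nonneg _), ← ENNReal.ofReal_mul (by positivity)]
      congr 1
      simp only [norm_mul, norm_neg, Complex.norm_I, Complex.norm_real, mul_pow, Real.norm_eq_abs,
        sq_abs]
      norm_num
    simp only [hv, smul_eq_mul, enorm_mul, mul_pow]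
    simp only [enorm_mul, mul_pow] at h1
    rw [h1, mul_assoc]
    gcongr
    exact enorm_bandCut_le u k ξ
  have hv2 : MemLp v 2 volume := by
    rw [memLp_two_iff hvi.1]
    exact (hvle.trans_lt (ENNReal.mul_lt_top ENNReal.ofReal_lt_top hB.lt_top)).ne
  have hw := wirtinger_two_sided hder (continuous_fourier_of_integrable hvi) h0 hρ hp hq N
  refine hw.trans (add_le_add_left ?_ _)
  change _ * ∫⁻ y, ‖𝓕 v y‖ₑ ^ 2 ≤ _
  rw [lintegral_fourier_sq hvi hv2]
  calc _ ≤ _ := mul_le_mul_right hvle _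
    _ = _ := by
      rw [← mul_assoc, ← ENNReal.ofReal_mul (by positivity)]
      congr 2
      field_simp

theorem tendsto_setLIntegral_Ioc {p : ℕ → ℝ} (hmono : Monotone p) (hp : Tendsto p atTop atTop)
    (F : ℝ → ℝ≥0∞) :
    Tendsto (fun N ↦ ∫⁻ y in Set.Ioc (p 0) (p N), F y) atTop
      (nhds (∫⁻ y in Set.Ioi (p 0), F y)) := by
  have h : Set.Ioi (p 0) = ⋃ N, Set.Ioc (p 0) (p N) := by
    ext y
    simp only [Set.mem_Ioi, Set.mem_iUnion, Set.mem_Ioc, exists_and_left, iff_self_and]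
    exact fun _ ↦ (hp.eventually_ge_atTop y).exists
  have hm : Monotone fun N ↦ Set.Ioc (p 0) (p N) := fun i j hij ↦
    Set.Ioc_subset_Ioc_right (hmono hij)
  rw [h, setLIntegral_iUnion_of_directed _ hm.directed_le]
  exact tendsto_atTop_iSup fun i j hij ↦ lintegral_mono_set (hm hij)

theorem lintegral_le_Ioi_add_Ioi_neg_add_Icc {p q R : ℝ} (hp : p ≤ R) (hq : q ≤ R) (F : ℝ → ℝ≥0∞) :
    ∫⁻ y, F y ≤ (∫⁻ y in Set.Ioi p, F y) + (∫⁻ y in Set.Ioi q, F (-y)) +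
      ∫⁻ y in Set.Icc (-R) R, F y := by
  have h1 : ∫⁻ y in Set.Ioi q, F (-y) = ∫⁻ y in Set.Iio (-q), F y := by
    have := (Measure.measurePreserving_neg (volume : Measure ℝ)).setLIntegral_comp_preimage_emb
      (MeasurableEquiv.neg ℝ).measurableEmbedding F (Set.Iio (-q))
    simpa using this
  rw [h1, ← setLIntegral_univ]
  calc _ ≤ ∫⁻ y in (Set.Ioi p ∪ Set.Iio (-q)) ∪ Set.Icc (-R) R, F y := by
        refine lintegral_mono_set fun y _ ↦ ?_
        simp only [Set.mem_union, Set.mem_Ioi, Set.mem_Iio, Set.mem_Icc]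
        by_contra! h
        exact absurd (h.2 (by linarith [h.1.2])) (by linarith [h.1.1])
    _ ≤ _ := (lintegral_union_le _ _ _).trans (by gcongr; exact lintegral_union_le _ _ _)

/-- A Wirtinger inequality for `h = 𝓕 u`: up to the values of `h` at the points `p n` and `-q n` and
its mass on `[-R, R]`, the weighted norm of `h` is at most `ρ` times that of `u`. -/
theorem wirtinger_fourier {u : ℝ → ℂ} (hu : Integrable u)
    {ρ₂ ρ : ℝ} (h0 : 0 < ρ₂) (hρ : ρ₂ < ρ) {p q : ℕ → ℝ} (hp : IsSquareChain ρ₂ p)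
    (hq : IsSquareChain ρ₂ q) (hpt : Tendsto p atTop atTop) (hqt : Tendsto q atTop atTop)
    {R : ℝ} (hpR : p 0 ≤ R) (hqR : q 0 ≤ R) :
    ∫⁻ y, ENNReal.ofReal (y ^ 2) * ‖𝓕 u y‖ₑ ^ 2 ≤
      ENNReal.ofReal (ρ ^ 2) * (∫⁻ ξ, ENNReal.ofReal (ξ ^ 2) * ‖u ξ‖ₑ ^ 2) +
      ((∑' n, bdryTerm ρ₂ ρ p (𝓕 u) n) + ∑' n, bdryTerm ρ₂ ρ q (fun y ↦ 𝓕 u (-y)) n) +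
      ENNReal.ofReal (R ^ 2) * ∫⁻ y in Set.Icc (-R) R, ‖𝓕 u y‖ₑ ^ 2 := by
  have hρ0 : 0 < ρ := h0.trans hρ
  by_cases hB : ∫⁻ ξ, ENNReal.ofReal (ξ ^ 2) * ‖u ξ‖ₑ ^ 2 = ∞
  · rw [hB, ENNReal.mul_top (by simpa using hρ0.ne')]
    simp
  refine (lintegral_le_Ioi_add_Ioi_neg_add_Icc hpR hqR _).trans (add_le_add ?_ ?_)
  · have hmp : Monotone p := monotone_nat_of_le_succ fun n ↦ (hp.lt_succ n).le
    have hmq : Monotone q := monotone_nat_of_le_succ fun n ↦ (hq.lt_succ n).le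
    simp only [neg_sq]
    refine le_of_tendsto' ((tendsto_setLIntegral_Ioc hmp hpt _).add
      (tendsto_setLIntegral_Ioc hmq hqt _)) fun N ↦ ?_
    refine (wirtinger_fourier_finite hu hB h0 hρ hp hq N).trans ?_
    gcongr <;> exact ENNReal.sum_le_tsum _
  · rw [← lintegral_const_mul' _ _ ENNReal.ofReal_ne_top]
    refine setLIntegral_mono' measurableSet_Icc fun y hy ↦ ?_
    gcongr ENNReal.ofReal ?_ * _
    exact sq_le_sq' hy.1 hy.2

theorem fourier_fourier_neg {h : ℝ → ℂ} (hc : Continuous h) (hi : Integrable h)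
    (hF : Integrable (𝓕 h)) : 𝓕 (fun ξ ↦ 𝓕 h (-ξ)) = h := by
  rw [← Real.fourierInv_eq_fourier_comp_neg, hc.fourierInv_fourier_eq hi hF]

theorem lintegral_weight_eq {u : ℝ → ℂ} (hu : AEMeasurable u) :
    ∫⁻ ξ, ENNReal.ofReal (1 + ξ ^ 2) * ‖u ξ‖ₑ ^ 2 =
      (∫⁻ ξ, ‖u ξ‖ₑ ^ 2) + ∫⁻ ξ, ENNReal.ofReal (ξ ^ 2) * ‖u ξ‖ₑ ^ 2 := by
  rw [← lintegral_add_left' (hu.enorm.pow_const 2)]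
  refine lintegral_congr fun ξ ↦ ?_
  rw [ENNReal.ofReal_add zero_le_one (by positivity), ENNReal.ofReal_one, add_mul, one_mul]

theorem enorm_sq_le_lintegral_fourier {h : ℝ → ℂ} (hc : Continuous h) (hi : Integrable h)
    (y : ℝ) : ‖h y‖ₑ ^ 2 ≤
      ENNReal.ofReal Real.pi * ∫⁻ ξ, ENNReal.ofReal (1 + ξ ^ 2) * ‖𝓕 h ξ‖ₑ ^ 2 := by
  have hFc := continuous_fourier_of_integrable hi
  by_cases hB : ∫⁻ ξ, ENNReal.ofReal (1 + ξ ^ 2) * ‖𝓕 h ξ‖ₑ ^ 2 = ∞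
  · rw [hB, ENNReal.mul_top (by simpa using Real.pi_pos)]
    exact le_top
  have hF := integrable_of_lintegral_weight hFc.aestronglyMeasurable hB
  refine le_trans ?_ (lintegral_enorm_sq_le _ hFc.aemeasurable)
  gcongr
  conv_lhs => rw [← fourier_fourier_neg hc hi hF]
  refine (enorm_fourier_le _ y).trans (le_of_eq ?_)
  exact lintegral_neg_eq_self (μ := volume) (fun ξ ↦ ‖𝓕 h ξ‖ₑ)

/-- The inequality of `wirtinger_fourier` for a continuous integrable function, in terms of its own
Fourier transform. -/
theorem wirtinger_of_continuous {h : ℝ → ℂ} (hc : Continuous h) (hi : Integrable h)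
    (h2 : MemLp h 2 volume)
    {ρ₂ ρ : ℝ} (h0 : 0 < ρ₂) (hρ : ρ₂ < ρ) {p q : ℕ → ℝ} (hp : IsSquareChain ρ₂ p)
    (hq : IsSquareChain ρ₂ q) (hpt : Tendsto p atTop atTop) (hqt : Tendsto q atTop atTop)
    {R : ℝ} (hpR : p 0 ≤ R) (hqR : q 0 ≤ R) :
    ∫⁻ y, ENNReal.ofReal (y ^ 2) * ‖h y‖ₑ ^ 2 ≤
      ENNReal.ofReal (ρ ^ 2) * (∫⁻ ξ, ENNReal.ofReal (ξ ^ 2) * ‖𝓕 h ξ‖ₑ ^ 2) +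
      ((∑' n, bdryTerm ρ₂ ρ p h n) + ∑' n, bdryTerm ρ₂ ρ q (fun y ↦ h (-y)) n) +
      ENNReal.ofReal (R ^ 2) * ∫⁻ y in Set.Icc (-R) R, ‖h y‖ₑ ^ 2 := by
  have hρ0 : 0 < ρ := h0.trans hρ
  have hFc := continuous_fourier_of_integrable hi
  by_cases hB : ∫⁻ ξ, ENNReal.ofReal (ξ ^ 2) * ‖𝓕 h ξ‖ₑ ^ 2 = ∞
  · rw [hB, ENNReal.mul_top (by simpa using hρ0.ne')]
    simp
  have hF : Integrable (𝓕 h) := by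
    refine integrable_of_lintegral_weight hFc.aestronglyMeasurable ?_
    rw [lintegral_weight_eq hFc.aemeasurable, lintegral_fourier_sq hi h2]
    exact ENNReal.add_ne_top.mpr ⟨(memLp_two_iff h2.1).mp h2, hB⟩
  have := wirtinger_fourier hF.comp_neg h0 hρ hp hq hpt hqt hpR hqR
  rw [fourier_fourier_neg hc hi hF] at this
  have e := lintegral_neg_eq_self (μ := volume) (fun ξ : ℝ ↦ ENNReal.ofReal (ξ ^ 2) * ‖𝓕 h ξ‖ₑ ^ 2)
  simp only [neg_sq] at e
  rwa [e] at this

/-! ### Chains of sampling points -/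

/-- The gap condition says that the squares of the sequence eventually move by at most `ρ₀`: indeed
`|s (i + 1)² - s i²| ≤ g (2 |s i| + g)` with `g = |s (i + 1) - s i|`, and `g → 0`. -/
theorem eventually_sq_step_le {s : ℤ → ℝ} {l : Filter ℤ} (hs : Tendsto (fun i ↦ |s i|) l atTop)
    {θ ρ₀ : ℝ} (hρ₀ : 0 < ρ₀) (hθ : 2 * θ < ρ₀)
    (hlim : limsup (fun i : ℤ => ((|s (i + 1) - s i| * |s i| : ℝ) : EReal)) l ≤ (θ : EReal)) :
    ∀ᶠ i in l, |s (i + 1) ^ 2 - s i ^ 2| ≤ ρ₀ := by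
  set θ' : ℝ := max ((θ + ρ₀ / 2) / 2) (ρ₀ / 4) with hθ'
  have h1 : θ < θ' := lt_max_of_lt_left (by linarith)
  have h3 : 2 * θ' < ρ₀ := by
    have : θ' < ρ₀ / 2 := max_lt (by linarith) (by linarith)
    linarith
  set e : ℝ := min (ρ₀ - 2 * θ') 1 with he
  have he0 : 0 < e := lt_min (by linarith) one_pos
  have hlt := eventually_lt_of_limsup_lt (hlim.trans_lt (EReal.coe_lt_coe_iff.mpr h1))
  filter_upwards [hlt, hs.eventually_ge_atTop (θ' / e)] with i hi hi'
  have hi : |s (i + 1) - s i| * |s i| < θ' := EReal.coe_lt_coe_iff.mp hi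
  set g := |s (i + 1) - s i| with hg
  have hg0 : 0 ≤ g := abs_nonneg _
  have hge : g ≤ e := by
    by_contra! hcon
    have : e * (θ' / e) ≤ g * |s i| := by gcongr
    rw [mul_div_cancel₀ _ he0.ne'] at this
    linarith
  have hsum : |s (i + 1) + s i| ≤ 2 * |s i| + g := by
    have : s (i + 1) + s i = 2 * s i + (s (i + 1) - s i) := by ring
    rw [this]
    refine (abs_add_le _ _).trans ?_
    rw [abs_mul]; norm_num [hg]
  have heq : s (i + 1) ^ 2 - s i ^ 2 = (s (i + 1) - s i) * (s (i + 1) + s i) := by ring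
  rw [heq, abs_mul]
  have h5 : g * g ≤ e * 1 := mul_le_mul hge (hge.trans (min_le_right _ _)) hg0 he0.le
  have h6 : e ≤ ρ₀ - 2 * θ' := min_le_left _ _
  nlinarith

/-- A sequence tending to infinity, not necessarily monotone or injective, whose squares move by
at most `ρ₀ < ρ₂` contains a chain whose squares are also separated by a fixed `δ > 0`. -/
theorem exists_chain {s : ℕ → ℝ} (hs : Tendsto s atTop atTop) {ρ₀ ρ₂ : ℝ} (h0 : 0 < ρ₀)
    (h2 : ρ₀ < ρ₂) (h21 : ρ₂ ≤ 1) (hstep : ∀ᶠ n in atTop, |s (n + 1) ^ 2 - s n ^ 2| ≤ ρ₀) :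
    ∃ (p : ℕ → ℝ) (δ : ℝ), 0 < δ ∧ IsSquareChain ρ₂ p ∧ (∀ n, ∃ k, p n = s k) ∧
      ∀ n, p n ^ 2 + δ ≤ p (n + 1) ^ 2 := by
  set δ : ℝ := (ρ₂ - ρ₀) / 2 with hδ
  have hδ0 : 0 < δ := by rw [hδ]; linarith
  obtain ⟨k₀, hk₀⟩ := (hstep.and (hs.eventually_ge_atTop 1)).exists_forall_of_atTop
  set R : ℝ := max (s k₀) (max 1 (1 / δ)) with hR
  have hR1 : 1 ≤ R := (le_max_left _ _).trans (le_max_right _ _)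
  have hRδ : 1 / δ ≤ R := (le_max_right _ _).trans (le_max_right _ _)
  have hnext : ∀ α, R ≤ α → ∃ β, (∃ k, β = s k) ∧ α < β ∧ α ^ 2 + δ ≤ β ^ 2 ∧
      β ^ 2 ≤ α ^ 2 + δ + ρ₀ := by
    intro α hα
    have hsq : Real.sqrt (α ^ 2 + δ) ^ 2 = α ^ 2 + δ := Real.sq_sqrt (by positivity)
    have hα' : α < Real.sqrt (α ^ 2 + δ) := Real.lt_sqrt_of_sq_lt (by linarith)
    have hex : ∃ k, Real.sqrt (α ^ 2 + δ) < s (k₀ + k) := by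
      obtain ⟨k, hk⟩ := ((hs.eventually_gt_atTop (Real.sqrt (α ^ 2 + δ))).and
        (eventually_ge_atTop k₀)).exists
      exact ⟨k - k₀, by rw [Nat.add_sub_cancel' hk.2]; exact hk.1⟩
    classical
    -- the first term beyond `√(α² + δ)`; its predecessor is not beyond
    obtain ⟨k, hk, hmin⟩ : ∃ k, Real.sqrt (α ^ 2 + δ) < s (k₀ + k) ∧
        ∀ j < k, s (k₀ + j) ≤ Real.sqrt (α ^ 2 + δ) :=
      ⟨Nat.find hex, Nat.find_spec hex, fun j hj ↦ not_lt.mp (Nat.find_min hex hj)⟩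
    have hk0 : k ≠ 0 := by
      rintro rfl
      have : s k₀ ≤ R := le_max_left _ _
      rw [add_zero] at hk
      linarith
    obtain ⟨j, rfl⟩ := Nat.exists_eq_succ_of_ne_zero hk0
    have hj := hmin j (Nat.lt_succ_self j)
    have hj' := hk₀ (k₀ + j) (Nat.le_add_right _ _)
    refine ⟨s (k₀ + j.succ), ⟨_, rfl⟩, hα'.trans hk, ?_, ?_⟩
    · rw [← hsq]
      exact pow_le_pow_left₀ (Real.sqrt_nonneg _) hk.le 2
    · have h3 : s (k₀ + j) ^ 2 ≤ α ^ 2 + δ := by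
        rw [← hsq]
        exact pow_le_pow_left₀ (by linarith [hj'.2]) hj 2
      have h4 := (abs_le.mp hj'.1).2
      have : k₀ + j.succ = k₀ + j + 1 := rfl
      rw [this]; linarith
  choose! F hF using hnext
  set p : ℕ → ℝ := fun n ↦ F^[n + 1] R with hp
  have hsucc : ∀ n, p (n + 1) = F (p n) := fun n ↦ Function.iterate_succ_apply' F (n + 1) R
  have hpR : ∀ n, R ≤ p n := by
    intro n
    induction n with
    | zero => exact (hF R le_rfl).2.1.le
    | succ n ih => rw [hsucc]; exact ih.trans (hF _ ih).2.1.le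
  refine ⟨p, δ, hδ0, ⟨fun n ↦ by linarith [hpR n], fun n ↦ ?_, fun n ↦ ?_⟩, fun n ↦ ?_, fun n ↦ ?_⟩
  · rw [hsucc]; exact (hF _ (hpR n)).2.1
  · have h3 := (hF _ (hpR n)).2.1
    have h4 := (hF _ (hpR n)).2.2.2
    rw [← hsucc] at h3 h4
    have h5 := hpR n
    set x := p n
    set y := p (n + 1)
    -- `2 y (y - x) = (y² - x²) + (y - x)²`, and the last square is at most `δ`
    have h9 : y - x ≤ δ := by
      have : 1 ≤ δ * R := by rwa [div_le_iff₀' hδ0] at hRδ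
      nlinarith
    nlinarith
  · cases n with
    | zero => exact (hF R le_rfl).1
    | succ n => rw [hsucc]; exact (hF _ (hpR n)).1
  · rw [hsucc]; exact (hF _ (hpR n)).2.2.1

theorem mul_le_sq_of_sq_step {δ : ℝ} {p : ℕ → ℝ} (hstep : ∀ n, p n ^ 2 + δ ≤ p (n + 1) ^ 2) (n : ℕ) :
    δ * n ≤ p n ^ 2 := by
  induction n with
  | zero => simp; positivity
  | succ n ih => push_cast; linarith [hstep n]

theorem tendsto_chain {ρ₂ δ : ℝ} {p : ℕ → ℝ} (hp : IsSquareChain ρ₂ p) (hδ : 0 < δ)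
    (hstep : ∀ n, p n ^ 2 + δ ≤ p (n + 1) ^ 2) : Tendsto p atTop atTop := by
  refine tendsto_atTop.mpr fun b ↦ ?_
  have h : Tendsto (fun n : ℕ ↦ δ * n) atTop atTop :=
    tendsto_natCast_atTop_atTop.const_mul_atTop hδ
  filter_upwards [h.eventually_ge_atTop (b ^ 2)] with n hn
  exact le_of_sq_le_sq (hn.trans (mul_le_sq_of_sq_step hstep n)) (hp.pos n).le

theorem summable_chain {ρ₂ δ a : ℝ} {p : ℕ → ℝ} (hp : IsSquareChain ρ₂ p) (h21 : ρ₂ ≤ 1) (hδ : 0 < δ)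
    (ha : 0 < a) (hstep : ∀ n, p n ^ 2 + δ ≤ p (n + 1) ^ 2) :
    Summable fun n ↦ p (n + 1) * Real.exp (-a * p n ^ 2) := by
  have hr : Real.exp (-(a * δ / 2)) < 1 := by
    rw [Real.exp_lt_one_iff]; have := mul_pos ha hδ; linarith
  refine Summable.of_nonneg_of_le (fun n ↦ mul_nonneg (hp.pos _).le (Real.exp_pos _).le)
    (fun n ↦ ?_) ((summable_geometric_of_lt_one (Real.exp_pos _).le hr).mul_left (2 / a + 2))
  have h1 := hp.pos n
  have h3 := hp.step n
  set t := p n ^ 2 with ht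
  have h5 : p (n + 1) ≤ t + 2 := by nlinarith [sq_nonneg (p n - 1)]
  have h6 : δ * n ≤ t := mul_le_sq_of_sq_step hstep n
  have ht0 : 0 ≤ t := sq_nonneg _
  have h7 : t + 2 ≤ (2 / a + 2) * Real.exp (a * t / 2) := by
    have e1 := Real.add_one_le_exp (a * t / 2)
    have e2 : t + 2 ≤ (2 / a + 2) * (a * t / 2 + 1) := by
      have : (2 / a + 2) * (a * t / 2 + 1) = t + 2 + 2 / a + a * t := by field_simp; ring
      rw [this]
      have : 0 < 2 / a := by positivity
      nlinarith [mul_nonneg ha.le ht0]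
    exact e2.trans (by gcongr)
  calc p (n + 1) * Real.exp (-a * t)
      ≤ ((2 / a + 2) * Real.exp (a * t / 2)) * Real.exp (-a * t) := by
        gcongr; exact h5.trans h7
    _ = (2 / a + 2) * Real.exp (-(a * t / 2)) := by
        rw [mul_assoc, ← Real.exp_add]; congr 2; ring
    _ ≤ (2 / a + 2) * Real.exp (-(a * δ / 2)) ^ n := by
        rw [← Real.exp_nat_mul]
        gcongr
        nlinarith [mul_le_mul_of_nonneg_left h6 ha.le]

/-! ### The short-time Fourier transform and the rearrangement inequality -/

/-- The product of `f` with the Gaussian `exp (-π t²)` centred at `x`. -/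
noncomputable def windowed (f : ℝ → ℂ) (x y : ℝ) : ℂ :=
  f y * (Real.exp (-Real.pi * (y - x) ^ 2) : ℂ)

/-- The short-time Fourier transform of `f` with Gaussian window. -/
noncomputable def stft (f : ℝ → ℂ) (x ξ : ℝ) : ℂ := 𝓕 (windowed f x) ξ

theorem enorm_windowed_sq (f : ℝ → ℂ) (x y : ℝ) :
    ‖windowed f x y‖ₑ ^ 2 = ‖f y‖ₑ ^ 2 * ENNReal.ofReal (Real.exp (-(2 * Real.pi) * (y - x) ^ 2)) := by
  rw [windowed, enorm_mul, mul_pow]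
  congr 1
  rw [← ofReal_norm, Complex.norm_real, Real.norm_eq_abs, Real.abs_exp,
    ← ENNReal.ofReal_pow (Real.exp_pos _).le, ← Real.exp_nat_mul]
  congr 2
  push_cast; ring

theorem norm_windowed_le (f : ℝ → ℂ) (x y : ℝ) : ‖windowed f x y‖ ≤ ‖f y‖ := by
  rw [windowed, norm_mul, Complex.norm_real, Real.norm_eq_abs, Real.abs_exp]
  refine mul_le_of_le_one_right (norm_nonneg _) (Real.exp_le_one_iff.mpr ?_)
  have := mul_nonneg Real.pi_pos.le (sq_nonneg (y - x))
  linarith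

theorem continuous_windowed {f : ℝ → ℂ} (hf : Continuous f) :
    Continuous fun z : ℝ × ℝ ↦ windowed f z.1 z.2 := by
  unfold windowed; fun_prop

theorem continuous_windowed_right {f : ℝ → ℂ} (hf : Continuous f) (x : ℝ) :
    Continuous (windowed f x) := by
  unfold windowed; fun_prop

theorem integrable_windowed {f : ℝ → ℂ} (hf : Continuous f) (hi : Integrable f) (x : ℝ) :
    Integrable (windowed f x) :=
  hi.mono (continuous_windowed_right hf x).aestronglyMeasurable
    (Eventually.of_forall fun y ↦ norm_windowed_le f x y)

theorem memLp_windowed {f : ℝ → ℂ} (hf : Continuous f) (h2 : MemLp f 2 volume) (x : ℝ) :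
    MemLp (windowed f x) 2 volume :=
  h2.mono (continuous_windowed_right hf x).aestronglyMeasurable
    (Eventually.of_forall fun y ↦ norm_windowed_le f x y)

theorem fourier_gaussian_one (t : ℝ) :
    𝓕 (fun η : ℝ ↦ (Real.exp (-Real.pi * η ^ 2) : ℂ)) t = (Real.exp (-Real.pi * t ^ 2) : ℂ) := by
  have h := congrFun (fourier_gaussian_pi (b := 1) (by simp)) t
  simp only [mul_one, Complex.one_cpow, div_one, one_mul] at h
  push_cast
  exact h

theorem integrable_gaussian_shift (ξ : ℝ) :
    Integrable fun η : ℝ ↦ (Real.exp (-Real.pi * (η - ξ) ^ 2) : ℂ) :=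
  ((integrable_exp_neg_mul_sq Real.pi_pos).comp_sub_right ξ).ofReal

/-- The Gaussian window is its own Fourier transform, so the short-time Fourier transforms of `f`
and `𝓕 f` agree up to a rotation of phase space and a unimodular factor. -/
theorem enorm_stft_eq {f : ℝ → ℂ} (hi : Integrable f) (x ξ : ℝ) :
    ‖stft f x ξ‖ₑ = ‖stft (𝓕 f) ξ (-x)‖ₑ := by
  set k : ℝ → ℂ := fun η ↦ (Real.fourierChar (x * (η - ξ)) : ℂ) *
    (Real.exp (-Real.pi * (η - ξ) ^ 2) : ℂ) with hk
  have hki : Integrable k := by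
    refine (integrable_gaussian_shift ξ).mono
      (Continuous.aestronglyMeasurable ?_) (Eventually.of_forall fun η ↦ ?_)
    · have := Real.continuous_fourierChar
      rw [hk]; fun_prop
    · rw [hk]; simp only [norm_mul, Circle.norm_coe, one_mul]; exact le_rfl
  have hFk : ∀ y, 𝓕 k y = (Real.fourierChar (-(y * ξ)) : ℂ) *
      (Real.exp (-Real.pi * (y - x) ^ 2) : ℂ) := by
    intro y
    rw [← fourier_gaussian_one, Real.fourier_real_eq, Real.fourier_real_eq,
      ← integral_const_mul, ← integral_add_right_eq_self _ ξ]
    refine integral_congr_ae (Eventually.of_forall fun η ↦ ?_)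
    simp only [hk, Circle.smul_def, smul_eq_mul, ← mul_assoc, add_sub_cancel_right]
    congr 1
    rw [← Circle.coe_mul, ← Circle.coe_mul, ← AddChar.map_add_eq_mul, ← AddChar.map_add_eq_mul]
    congr 2
    ring
  have h1 : stft f x ξ = ∫ y, 𝓕 k y * f y := by
    rw [stft, Real.fourier_real_eq]
    refine integral_congr_ae (Eventually.of_forall fun y ↦ ?_)
    simp only [hFk, windowed, Circle.smul_def, smul_eq_mul]
    ring
  have h2 : ∫ η, k η * 𝓕 f η = (Real.fourierChar (-(x * ξ)) : ℂ) * stft (𝓕 f) ξ (-x) := by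
    rw [stft, Real.fourier_real_eq, ← integral_const_mul]
    refine integral_congr_ae (Eventually.of_forall fun η ↦ ?_)
    have : x * (η - ξ) = -(x * ξ) + -(η * -x) := by ring
    simp only [hk, windowed, Circle.smul_def, smul_eq_mul]
    rw [this, AddChar.map_add_eq_mul, Circle.coe_mul]
    ring
  rw [h1, integral_fourier_mul_eq hi hki, h2, enorm_mul]
  have : ‖(Real.fourierChar (-(x * ξ)) : ℂ)‖ₑ = 1 := by
    rw [← ofReal_norm, Circle.norm_coe, ENNReal.ofReal_one]
  rw [this, one_mul]

theorem measurable_enorm_stft {f : ℝ → ℂ} (hf : Continuous f) :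
    Measurable fun z : ℝ × ℝ ↦ ‖stft f z.1 z.2‖ₑ ^ 2 := by
  have h : StronglyMeasurable fun z : ℝ × ℝ ↦ stft f z.1 z.2 := by
    have hc : Continuous fun w : (ℝ × ℝ) × ℝ ↦
        Real.fourierChar (-(w.2 * w.1.2)) • windowed f w.1.1 w.2 := by
      have h1 : Continuous fun w : (ℝ × ℝ) × ℝ ↦ windowed f w.1.1 w.2 :=
        (continuous_windowed hf).comp (by fun_prop : Continuous fun w : (ℝ × ℝ) × ℝ ↦ (w.1.1, w.2))
      simp only [Circle.smul_def]
      fun_prop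
    have := hc.stronglyMeasurable.integral_prod_right' (ν := (volume : Measure ℝ))
    simpa only [stft, Real.fourier_real_eq] using this
  exact h.measurable.enorm.pow_const 2

theorem measurable_enorm_stft_right {f : ℝ → ℂ} (hf : Continuous f) (x : ℝ) :
    Measurable fun ξ : ℝ ↦ ‖stft f x ξ‖ₑ ^ 2 := by
  have := (measurable_enorm_stft hf).comp (measurable_prodMk_left (x := x))
  exact this

theorem lintegral_stft_sq {f : ℝ → ℂ} (hf : Continuous f) (hi : Integrable f)
    (h2 : MemLp f 2 volume) (x : ℝ) :
    ∫⁻ ξ, ‖stft f x ξ‖ₑ ^ 2 = ∫⁻ y, ‖windowed f x y‖ₑ ^ 2 :=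
  lintegral_fourier_sq (integrable_windowed hf hi x) (memLp_windowed hf h2 x)

-- from here on `stft` is used only through the lemmas above
attribute [irreducible] stft

/-- `∫∫ x² m(x) |V f(x, ξ)|² dξ dx` -/
noncomputable def posEnergy (m : ℝ → ℝ≥0∞) (f : ℝ → ℂ) : ℝ≥0∞ :=
  ∫⁻ x, ∫⁻ ξ, ENNReal.ofReal (x ^ 2) * m x * ‖stft f x ξ‖ₑ ^ 2

/-- `∫∫ ξ² m(x) |V f(x, ξ)|² dξ dx` -/
noncomputable def freqEnergy (m : ℝ → ℝ≥0∞) (f : ℝ → ℂ) : ℝ≥0∞ :=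
  ∫⁻ x, ∫⁻ ξ, ENNReal.ofReal (ξ ^ 2) * m x * ‖stft f x ξ‖ₑ ^ 2

theorem lintegral_stft_fourier {f : ℝ → ℂ} (hf : Continuous f) (hi : Integrable f)
    (W : ℝ → ℝ → ℝ≥0∞) (hW : Measurable fun z : ℝ × ℝ ↦ W z.1 z.2)
    (hWn : ∀ x ξ, W x (-ξ) = W x ξ) :
    ∫⁻ x, ∫⁻ ξ, W x ξ * ‖stft (𝓕 f) x ξ‖ₑ ^ 2 = ∫⁻ x, ∫⁻ ξ, W ξ x * ‖stft f x ξ‖ₑ ^ 2 := by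
  have h1 : ∀ x, ∫⁻ ξ, W x ξ * ‖stft (𝓕 f) x ξ‖ₑ ^ 2 = ∫⁻ ξ, W x ξ * ‖stft f ξ x‖ₑ ^ 2 := by
    intro x
    refine (lintegral_neg_eq_self (μ := volume)
      fun ξ ↦ W x ξ * ‖stft (𝓕 f) x ξ‖ₑ ^ 2).symm.trans (lintegral_congr fun ξ ↦ ?_)
    rw [hWn, enorm_stft_eq hi ξ x]
  simp only [h1]
  have h0 : Measurable fun z : ℝ × ℝ ↦ ‖stft f z.2 z.1‖ₑ ^ 2 :=
    (measurable_enorm_stft hf).comp measurable_swap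
  have hmeas : Measurable fun z : ℝ × ℝ ↦ W z.1 z.2 * ‖stft f z.2 z.1‖ₑ ^ 2 :=
    by fun_prop
  exact lintegral_lintegral_swap hmeas.aemeasurable

theorem ENNReal.mul_add_mul_le_of_le {p q a b : ℝ≥0∞} (hpq : p ≤ q) (hab : a ≤ b) :
    p * b + q * a ≤ q * b + p * a := by
  obtain ⟨d, rfl⟩ := exists_add_of_le hpq
  obtain ⟨e, rfl⟩ := exists_add_of_le hab
  calc p * (a + e) + (p + d) * a ≤ p * (a + e) + (p + d) * a + d * e := le_self_add
    _ = _ := by ring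

/-- The uncertainty step: passing from `f` to `𝓕 f` exchanges the two coordinates of phase space,
and `(x² - ξ²) (m x - m ξ) ≥ 0` for an even weight `m` increasing in `|x|`. -/
theorem freqEnergy_add_le {m : ℝ → ℝ≥0∞} (hm : Measurable m)
    (hmono : ∀ x y, |x| ≤ |y| → m x ≤ m y) {f : ℝ → ℂ} (hf : Continuous f) (hi : Integrable f) :
    freqEnergy m f + freqEnergy m (𝓕 f) ≤ posEnergy m f + posEnergy m (𝓕 f) := by
  have hV := measurable_enorm_stft hf
  have e1 : freqEnergy m (𝓕 f) = ∫⁻ x, ∫⁻ ξ, ENNReal.ofReal (x ^ 2) * m ξ * ‖stft f x ξ‖ₑ ^ 2 :=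
    lintegral_stft_fourier hf hi (fun x ξ ↦ ENNReal.ofReal (ξ ^ 2) * m x) (by fun_prop)
      (fun x ξ ↦ by simp only [neg_sq])
  have e2 : posEnergy m (𝓕 f) = ∫⁻ x, ∫⁻ ξ, ENNReal.ofReal (ξ ^ 2) * m ξ * ‖stft f x ξ‖ₑ ^ 2 :=
    lintegral_stft_fourier hf hi (fun x ξ ↦ ENNReal.ofReal (x ^ 2) * m x) (by fun_prop)
      (fun x ξ ↦ rfl)
  rw [e1, e2, freqEnergy, posEnergy]
  have h1 : Measurable fun z : ℝ × ℝ ↦ ENNReal.ofReal (z.2 ^ 2) * m z.1 * ‖stft f z.1 z.2‖ₑ ^ 2 :=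
    by fun_prop
  have h2 : Measurable fun z : ℝ × ℝ ↦ ENNReal.ofReal (z.1 ^ 2) * m z.1 * ‖stft f z.1 z.2‖ₑ ^ 2 :=
    by fun_prop
  have h1' : Measurable fun x : ℝ ↦ ∫⁻ ξ, ENNReal.ofReal (ξ ^ 2) * m x * ‖stft f x ξ‖ₑ ^ 2 :=
    h1.lintegral_prod_right'
  have h2' : Measurable fun x : ℝ ↦ ∫⁻ ξ, ENNReal.ofReal (x ^ 2) * m x * ‖stft f x ξ‖ₑ ^ 2 :=
    h2.lintegral_prod_right'
  rw [← lintegral_add_left h1', ← lintegral_add_left h2']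
  refine lintegral_mono fun x ↦ ?_
  have hVx := measurable_enorm_stft_right hf x
  have h1x : Measurable fun ξ : ℝ ↦ ENNReal.ofReal (ξ ^ 2) * m x * ‖stft f x ξ‖ₑ ^ 2 :=
    by fun_prop
  have h2x : Measurable fun ξ : ℝ ↦ ENNReal.ofReal (x ^ 2) * m x * ‖stft f x ξ‖ₑ ^ 2 :=
    by fun_prop
  rw [← lintegral_add_left h1x, ← lintegral_add_left h2x]
  refine lintegral_mono fun ξ ↦ ?_
  simp only [← add_mul]
  refine mul_le_mul_left ?_ _
  -- rearrangement inequality for the similarly ordered pairs `(x², ξ²)` and `(m x, m ξ)`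
  have hsq : ∀ {s t : ℝ}, |s| ≤ |t| → ENNReal.ofReal (s ^ 2) ≤ ENNReal.ofReal (t ^ 2) :=
    fun h ↦ ENNReal.ofReal_le_ofReal (sq_le_sq.mpr h)
  rcases le_total |x| |ξ| with h | h
  · rw [add_comm (_ * m x) (_ * m ξ), add_comm (_ * m x) (_ * m ξ)]
    exact ENNReal.mul_add_mul_le_of_le (hsq h) (hmono _ _ h)
  · exact ENNReal.mul_add_mul_le_of_le (hsq h) (hmono _ _ h)

/-! ### Weighted energy estimates -/

/-- `∫ m(x) ∫ y² |f(y)|² exp (-2π (y - x)²) dy dx` -/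
noncomputable def localEnergy (m : ℝ → ℝ≥0∞) (f : ℝ → ℂ) : ℝ≥0∞ :=
  ∫⁻ x, m x * ∫⁻ y, ENNReal.ofReal (y ^ 2) * ‖windowed f x y‖ₑ ^ 2

theorem measurable_enorm_windowed {f : ℝ → ℂ} (hf : Continuous f) :
    Measurable fun z : ℝ × ℝ ↦ ‖windowed f z.1 z.2‖ₑ ^ 2 :=
  (continuous_windowed hf).measurable.enorm.pow_const 2

theorem measurable_enorm_windowed_left {f : ℝ → ℂ} (hf : Continuous f) (y : ℝ) :
    Measurable fun x : ℝ ↦ ‖windowed f x y‖ₑ ^ 2 := by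
  have := (measurable_enorm_windowed hf).comp (measurable_prodMk_right (y := y))
  exact this

theorem measurable_enorm_windowed_right {f : ℝ → ℂ} (hf : Continuous f) (x : ℝ) :
    Measurable fun y : ℝ ↦ ‖windowed f x y‖ₑ ^ 2 := by
  have := (measurable_enorm_windowed hf).comp (measurable_prodMk_left (x := x))
  exact this

theorem sq_mul_exp_le {c η : ℝ} (hc : 0 ≤ c) (hη : 0 < η) (hcη : c * (1 + 1 / η) ^ 2 ≤ Real.pi)
    {x y : ℝ} (h : η * |y| < |y - x|) :
    x ^ 2 * (Real.exp (c * x ^ 2) * Real.exp (-(2 * Real.pi) * (y - x) ^ 2)) ≤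
      (1 + 1 / η) ^ 2 * ((y - x) ^ 2 * Real.exp (-Real.pi * (y - x) ^ 2)) := by
  have h1 : |x| ≤ (1 + 1 / η) * |y - x| := by
    have h2 : |y| ≤ 1 / η * |y - x| := by
      rw [div_mul_eq_mul_div, one_mul, le_div_iff₀ hη]; linarith
    have h3 : |x| ≤ |y| + |y - x| := by
      have := abs_sub_abs_le_abs_sub x y
      rw [abs_sub_comm x y] at this; linarith
    linarith
  have h4 : x ^ 2 ≤ (1 + 1 / η) ^ 2 * (y - x) ^ 2 := by
    rw [← sq_abs x, ← sq_abs (y - x), ← mul_pow]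
    exact pow_le_pow_left₀ (abs_nonneg _) h1 2
  have h5 : c * x ^ 2 ≤ Real.pi * (y - x) ^ 2 :=
    calc c * x ^ 2 ≤ c * ((1 + 1 / η) ^ 2 * (y - x) ^ 2) := by gcongr
      _ = c * (1 + 1 / η) ^ 2 * (y - x) ^ 2 := by ring
      _ ≤ _ := by gcongr
  rw [← Real.exp_add, ← mul_assoc]
  gcongr
  linarith

theorem lintegral_gaussian_moment_ne_top :
    ∫⁻ z : ℝ, ENNReal.ofReal (z ^ 2 * Real.exp (-Real.pi * z ^ 2)) ≠ ∞ := by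
  have h := integrable_rpow_mul_exp_neg_mul_sq (b := Real.pi) (s := 2) Real.pi_pos (by norm_num)
  have h' : Integrable fun z : ℝ ↦ z ^ 2 * Real.exp (-Real.pi * z ^ 2) := by
    simpa using h
  exact h'.lintegral_lt_top.ne

/-- The Gaussian window concentrates at `y = x`: where `|y - x| ≤ η |y|` one has
`x² ≤ (1 + η)² y²`, and elsewhere the window absorbs the weight. -/
theorem posEnergy_le {m : ℝ → ℝ≥0∞} {c η : ℝ} (hc : 0 ≤ c) (hη : 0 < η)
    (hcη : c * (1 + 1 / η) ^ 2 ≤ Real.pi) (hmc : ∀ x, m x ≤ ENNReal.ofReal (Real.exp (c * x ^ 2)))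
    {f : ℝ → ℂ} (hf : Continuous f) (hi : Integrable f) (h2 : MemLp f 2 volume) :
    posEnergy m f ≤ ENNReal.ofReal ((1 + η) ^ 2) * localEnergy m f +
      ENNReal.ofReal ((1 + 1 / η) ^ 2) *
        ((∫⁻ z : ℝ, ENNReal.ofReal (z ^ 2 * Real.exp (-Real.pi * z ^ 2))) * ∫⁻ y, ‖f y‖ₑ ^ 2) := by
  have e1 : posEnergy m f =
      ∫⁻ x, ∫⁻ y, ENNReal.ofReal (x ^ 2) * m x * ‖windowed f x y‖ₑ ^ 2 := by
    refine lintegral_congr fun x ↦ ?_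
    rw [lintegral_const_mul _ (measurable_enorm_stft_right hf x),
      lintegral_const_mul _ (measurable_enorm_windowed_right hf x), lintegral_stft_sq hf hi h2]
  have e2 : localEnergy m f =
      ∫⁻ x, ∫⁻ y, m x * (ENNReal.ofReal (y ^ 2) * ‖windowed f x y‖ₑ ^ 2) := by
    refine lintegral_congr fun x ↦ ?_
    have := measurable_enorm_windowed_right hf x
    rw [lintegral_const_mul _ (by fun_prop)]
  set k : ℝ → ℝ≥0∞ := fun z ↦ ENNReal.ofReal (z ^ 2 * Real.exp (-Real.pi * z ^ 2)) with hk
  have hfm := hf.measurable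
  have e3 : (∫⁻ z, k z) * ∫⁻ y, ‖f y‖ₑ ^ 2 = ∫⁻ x, ∫⁻ y, k (y - x) * ‖f y‖ₑ ^ 2 := by
    have hmeas : Measurable fun z : ℝ × ℝ ↦ k (z.2 - z.1) * ‖f z.2‖ₑ ^ 2 := by fun_prop
    rw [lintegral_lintegral_swap hmeas.aemeasurable, ← lintegral_const_mul _ (by fun_prop)]
    refine lintegral_congr fun y ↦ ?_
    rw [lintegral_mul_const _ (by fun_prop), lintegral_sub_left_eq_self k y]
  have hpt : ∀ x y, ENNReal.ofReal (x ^ 2) * m x * ‖windowed f x y‖ₑ ^ 2 ≤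
      ENNReal.ofReal ((1 + η) ^ 2) * (m x * (ENNReal.ofReal (y ^ 2) * ‖windowed f x y‖ₑ ^ 2)) +
      ENNReal.ofReal ((1 + 1 / η) ^ 2) * (k (y - x) * ‖f y‖ₑ ^ 2) := by
    intro x y
    rcases le_or_gt |y - x| (η * |y|) with h | h
    · refine le_add_right ?_
      have h1 : x ^ 2 ≤ (1 + η) ^ 2 * y ^ 2 := by
        have h3 : |x| ≤ (1 + η) * |y| := by
          have := abs_sub_abs_le_abs_sub x y
          rw [abs_sub_comm x y] at this; linarith
        rw [← sq_abs x, ← sq_abs y, ← mul_pow]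
        exact pow_le_pow_left₀ (abs_nonneg _) h3 2
      calc _ ≤ ENNReal.ofReal ((1 + η) ^ 2 * y ^ 2) * m x * ‖windowed f x y‖ₑ ^ 2 := by gcongr
        _ = _ := by rw [ENNReal.ofReal_mul (by positivity)]; ring
    · refine le_add_left ?_
      have h1 := ENNReal.ofReal_le_ofReal (sq_mul_exp_le hc hη hcη h)
      rw [ENNReal.ofReal_mul (by positivity), ENNReal.ofReal_mul (by positivity),
        ENNReal.ofReal_mul (by positivity)] at h1
      calc _ ≤ ENNReal.ofReal (x ^ 2) * ENNReal.ofReal (Real.exp (c * x ^ 2)) *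
            ‖windowed f x y‖ₑ ^ 2 := by gcongr; exact hmc x
        _ = (ENNReal.ofReal (x ^ 2) * (ENNReal.ofReal (Real.exp (c * x ^ 2)) *
            ENNReal.ofReal (Real.exp (-(2 * Real.pi) * (y - x) ^ 2)))) * ‖f y‖ₑ ^ 2 := by
          rw [enorm_windowed_sq]; ring
        _ ≤ _ := mul_le_mul_left h1 _
        _ = _ := mul_assoc _ _ _
  rw [e1, e2, e3, ← lintegral_const_mul' _ _ ENNReal.ofReal_ne_top,
    ← lintegral_const_mul' _ _ ENNReal.ofReal_ne_top]
  have hA : Measurable fun z : ℝ × ℝ ↦ ENNReal.ofReal ((1 + 1 / η) ^ 2) *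
      (k (z.2 - z.1) * ‖f z.2‖ₑ ^ 2) := by fun_prop
  simp only [← lintegral_const_mul' _ _ ENNReal.ofReal_ne_top]
  rw [← lintegral_add_right _ hA.lintegral_prod_right']
  refine lintegral_mono fun x ↦ ?_
  rw [← lintegral_add_right _ (by fun_prop)]
  exact lintegral_mono fun y ↦ hpt x y

/-- A Gaussian-bounded weight integrated against the window at `r` costs at most `exp (2 c r²)`. -/
theorem lintegral_weight_windowed_le {m : ℝ → ℝ≥0∞} {c : ℝ} (hc : 2 * c ≤ Real.pi)
    (hmc : ∀ x, m x ≤ ENNReal.ofReal (Real.exp (c * x ^ 2))) (hc0 : 0 ≤ c) (f : ℝ → ℂ) (r : ℝ) :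
    ∫⁻ x, m x * ‖windowed f x r‖ₑ ^ 2 ≤
      ENNReal.ofReal (Real.exp (2 * c * r ^ 2)) * ‖f r‖ₑ ^ 2 := by
  have hpt : ∀ x, m x * ‖windowed f x r‖ₑ ^ 2 ≤ ENNReal.ofReal (Real.exp (2 * c * r ^ 2)) *
      ‖f r‖ₑ ^ 2 * ENNReal.ofReal (Real.exp (-Real.pi * (r - x) ^ 2)) := by
    intro x
    rw [enorm_windowed_sq]
    have h1 : Real.exp (c * x ^ 2) * Real.exp (-(2 * Real.pi) * (r - x) ^ 2) ≤
        Real.exp (2 * c * r ^ 2) * Real.exp (-Real.pi * (r - x) ^ 2) := by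
      rw [← Real.exp_add, ← Real.exp_add]
      refine Real.exp_le_exp.mpr ?_
      nlinarith [mul_nonneg hc0 (sq_nonneg (2 * r - x)),
        mul_nonneg (sub_nonneg.mpr hc) (sq_nonneg (r - x))]
    have h2 := ENNReal.ofReal_le_ofReal h1
    rw [ENNReal.ofReal_mul (by positivity), ENNReal.ofReal_mul (by positivity)] at h2
    calc _ ≤ ENNReal.ofReal (Real.exp (c * x ^ 2)) * (‖f r‖ₑ ^ 2 *
          ENNReal.ofReal (Real.exp (-(2 * Real.pi) * (r - x) ^ 2))) := by gcongr; exact hmc x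
      _ = (ENNReal.ofReal (Real.exp (c * x ^ 2)) *
          ENNReal.ofReal (Real.exp (-(2 * Real.pi) * (r - x) ^ 2))) * ‖f r‖ₑ ^ 2 := by ring
      _ ≤ _ := mul_le_mul_left h2 _
      _ = _ := by ring
  refine (lintegral_mono hpt).trans (le_of_eq ?_)
  rw [lintegral_const_mul _ (by fun_prop), lintegral_sub_left_eq_self
    (fun z ↦ ENNReal.ofReal (Real.exp (-Real.pi * z ^ 2))) r,
    ← ofReal_integral_eq_lintegral_ofReal (integrable_exp_neg_mul_sq Real.pi_pos)
      (Eventually.of_forall fun x ↦ (Real.exp_pos _).le), integral_gaussian]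
  simp [Real.pi_pos.ne']

/-- The boundary terms of the windowed functions stay bounded after integration against the weight,
because the rate `a` of decay of `f` along the chain beats the growth `2c` of the weight. -/
theorem lintegral_weight_bdry_le {m : ℝ → ℝ≥0∞} (hm : Measurable m) {a c C K : ℝ} (ha : 0 ≤ a)
    (hc : 2 * c ≤ Real.pi) (hc0 : 0 ≤ c) (hca : 2 * c ≤ a)
    (hmc : ∀ x, m x ≤ ENNReal.ofReal (Real.exp (c * x ^ 2))) {f : ℝ → ℂ} (hf : Continuous f)
    {p r : ℕ → ℝ} (hp : ∀ n, 0 < p n) (hpm : ∀ n, p n ≤ p (n + 1)) (hr : ∀ n, r n ^ 2 = p n ^ 2)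
    (hfr : ∀ n, ‖f (r n)‖ ≤ C * Real.exp (-a * |r n| ^ 2)) :
    ∫⁻ x, m x * ∑' n, ENNReal.ofReal (K * p (n + 1)) *
        (‖windowed f x (r n)‖ₑ ^ 2 + ‖windowed f x (r (n + 1))‖ₑ ^ 2) ≤
      ENNReal.ofReal K * (2 * ENNReal.ofReal (C ^ 2) *
        ∑' n, ENNReal.ofReal (p (n + 1) * Real.exp (-a * p n ^ 2))) := by
  have hpt : ∀ n, ∫⁻ x, m x * ‖windowed f x (r n)‖ₑ ^ 2 ≤
      ENNReal.ofReal (C ^ 2) * ENNReal.ofReal (Real.exp (-a * p n ^ 2)) := by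
    intro n
    refine (lintegral_weight_windowed_le hc hmc hc0 f (r n)).trans ?_
    have h1 : ‖f (r n)‖ₑ ^ 2 ≤ ENNReal.ofReal ((C * Real.exp (-a * |r n| ^ 2)) ^ 2) := by
      rw [← ofReal_norm, ← ENNReal.ofReal_pow (norm_nonneg _)]
      exact ENNReal.ofReal_le_ofReal (pow_le_pow_left₀ (norm_nonneg _) (hfr n) 2)
    refine (mul_le_mul_right h1 _).trans ?_
    rw [← ENNReal.ofReal_mul (by positivity), ← ENNReal.ofReal_mul (by positivity)]
    refine ENNReal.ofReal_le_ofReal ?_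
    have h2 : Real.exp (2 * c * r n ^ 2) * (C * Real.exp (-a * |r n| ^ 2)) ^ 2 =
        C ^ 2 * Real.exp ((2 * c - 2 * a) * p n ^ 2) := by
      rw [mul_pow, ← Real.exp_nat_mul, sq_abs, hr, mul_left_comm, ← Real.exp_add]
      congr 2; push_cast; ring
    rw [h2]
    gcongr
    linarith
  have hmeas := measurable_enorm_windowed_left hf
  simp only [← ENNReal.tsum_mul_left]
  rw [lintegral_tsum fun n ↦ by fun_prop]
  refine ENNReal.tsum_le_tsum fun n ↦ ?_
  have hexp : Real.exp (-a * p (n + 1) ^ 2) ≤ Real.exp (-a * p n ^ 2) := by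
    have := pow_le_pow_left₀ (hp n).le (hpm n) 2
    gcongr Real.exp ?_
    nlinarith
  calc ∫⁻ x, m x * (ENNReal.ofReal (K * p (n + 1)) *
        (‖windowed f x (r n)‖ₑ ^ 2 + ‖windowed f x (r (n + 1))‖ₑ ^ 2))
      = ∫⁻ x, ENNReal.ofReal (K * p (n + 1)) *
        (m x * ‖windowed f x (r n)‖ₑ ^ 2 + m x * ‖windowed f x (r (n + 1))‖ₑ ^ 2) :=
        lintegral_congr fun x ↦ by ring
    _ = ENNReal.ofReal (K * p (n + 1)) * ((∫⁻ x, m x * ‖windowed f x (r n)‖ₑ ^ 2) +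
        ∫⁻ x, m x * ‖windowed f x (r (n + 1))‖ₑ ^ 2) := by
        rw [lintegral_const_mul' _ _ ENNReal.ofReal_ne_top, lintegral_add_left (by fun_prop)]
    _ ≤ ENNReal.ofReal (K * p (n + 1)) *
        (ENNReal.ofReal (C ^ 2) * ENNReal.ofReal (Real.exp (-a * p n ^ 2)) +
        ENNReal.ofReal (C ^ 2) * ENNReal.ofReal (Real.exp (-a * p n ^ 2))) := by
        gcongr
        · exact hpt n
        · exact (hpt (n + 1)).trans (mul_le_mul_right (ENNReal.ofReal_le_ofReal hexp) _)
    _ = _ := by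
        rw [ENNReal.ofReal_mul' (hp _).le, ENNReal.ofReal_mul (hp _).le]; ring

theorem localEnergy_ne_top {m : ℝ → ℝ≥0∞} {M : ℝ≥0∞} (hM : M ≠ ∞) (hmM : ∀ x, m x ≤ M)
    {f : ℝ → ℂ} (hf : Continuous f)
    (hw : ∫⁻ y, ENNReal.ofReal (1 + y ^ 2) * ‖f y‖ₑ ^ 2 ≠ ∞) : localEnergy m f ≠ ∞ := by
  have hmeas := measurable_enorm_windowed hf
  have h1 : localEnergy m f ≤
      M * ∫⁻ x, ∫⁻ y, ENNReal.ofReal (y ^ 2) * ‖windowed f x y‖ₑ ^ 2 := by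
    rw [← lintegral_const_mul' _ _ hM]
    exact lintegral_mono fun x ↦ mul_le_mul_left (hmM x) _
  have h2 : ∫⁻ x, ∫⁻ y, ENNReal.ofReal (y ^ 2) * ‖windowed f x y‖ₑ ^ 2 ≤
      ∫⁻ y, ENNReal.ofReal (1 + y ^ 2) * ‖f y‖ₑ ^ 2 := by
    have hm2 : Measurable fun z : ℝ × ℝ ↦ ENNReal.ofReal (z.2 ^ 2) * ‖windowed f z.1 z.2‖ₑ ^ 2 := by
      fun_prop
    rw [lintegral_lintegral_swap hm2.aemeasurable]
    refine lintegral_mono fun y ↦ ?_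
    have h3 := lintegral_weight_windowed_le (m := fun _ ↦ 1) (c := 0) (by simpa using Real.pi_pos.le)
      (fun x ↦ by simp) le_rfl f y
    simp only [one_mul, mul_zero, zero_mul, Real.exp_zero, ENNReal.ofReal_one] at h3
    rw [lintegral_const_mul _ (measurable_enorm_windowed_left hf y)]
    gcongr
    linarith
  exact ne_top_of_le_ne_top (ENNReal.mul_ne_top hM (ne_top_of_le_ne_top hw h2)) h1

/-! ### Gaussian decay -/

theorem lintegral_windowed_sq_le {f : ℝ → ℂ} (hf : Continuous f) :
    ∫⁻ x, ∫⁻ y, ‖windowed f x y‖ₑ ^ 2 ≤ ∫⁻ y, ‖f y‖ₑ ^ 2 := by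
  rw [lintegral_lintegral_swap (measurable_enorm_windowed hf).aemeasurable]
  refine lintegral_mono fun y ↦ ?_
  have h3 := lintegral_weight_windowed_le (m := fun _ ↦ 1) (c := 0) (by simpa using Real.pi_pos.le)
    (fun x ↦ by simp) le_rfl f y
  simpa using h3

/-- Wirtinger's inequality applied to every windowed function `f exp (-π (· - x)²)` and integrated
over `x`. The error `B` does not depend on the weight `m`. -/
theorem localEnergy_le_of_chain {ρ₂ ρ a c C δ δ' : ℝ} (h0 : 0 < ρ₂) (hρ : ρ₂ < ρ) (h21 : ρ₂ ≤ 1)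
    (ha : 0 < a) (hc : 2 * c ≤ Real.pi) (hc0 : 0 ≤ c) (hca : 2 * c ≤ a)
    {p q : ℕ → ℝ} (hp : IsSquareChain ρ₂ p) (hq : IsSquareChain ρ₂ q) (hδ : 0 < δ) (hδ' : 0 < δ')
    (hpδ : ∀ n, p n ^ 2 + δ ≤ p (n + 1) ^ 2) (hqδ : ∀ n, q n ^ 2 + δ' ≤ q (n + 1) ^ 2)
    {f : ℝ → ℂ} (hf : Continuous f) (hi : Integrable f) (h2 : MemLp f 2 volume)
    (hfp : ∀ n, ‖f (p n)‖ ≤ C * Real.exp (-a * |p n| ^ 2))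
    (hfq : ∀ n, ‖f (-q n)‖ ≤ C * Real.exp (-a * |-q n| ^ 2)) :
    ∃ B : ℝ≥0∞, B ≠ ∞ ∧ ∀ m : ℝ → ℝ≥0∞, Measurable m →
      (∀ x, m x ≤ ENNReal.ofReal (Real.exp (c * x ^ 2))) →
      localEnergy m f ≤ ENNReal.ofReal (ρ ^ 2) * freqEnergy m f + B := by
  set R : ℝ := max (p 0) (q 0) with hR
  have hf2 : ∫⁻ y, ‖f y‖ₑ ^ 2 ≠ ∞ := (memLp_two_iff h2.1).mp h2
  set S : (ℕ → ℝ) → ℝ≥0∞ := fun p ↦ ENNReal.ofReal (bdryConst ρ₂ ρ) *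
    (2 * ENNReal.ofReal (C ^ 2) * ∑' n, ENNReal.ofReal (p (n + 1) * Real.exp (-a * p n ^ 2))) with hS
  have hSp : S p ≠ ∞ := ENNReal.mul_ne_top ENNReal.ofReal_ne_top (ENNReal.mul_ne_top
    (ENNReal.mul_ne_top (by simp) ENNReal.ofReal_ne_top)
    (summable_chain hp h21 hδ ha hpδ).tsum_ofReal_ne_top)
  have hSq : S q ≠ ∞ := ENNReal.mul_ne_top ENNReal.ofReal_ne_top (ENNReal.mul_ne_top
    (ENNReal.mul_ne_top (by simp) ENNReal.ofReal_ne_top)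
    (summable_chain hq h21 hδ' ha hqδ).tsum_ofReal_ne_top)
  refine ⟨(S p + S q) + ENNReal.ofReal (R ^ 2) *
    (ENNReal.ofReal (Real.exp (2 * c * R ^ 2)) * ∫⁻ y, ‖f y‖ₑ ^ 2),
    ENNReal.add_ne_top.mpr ⟨ENNReal.add_ne_top.mpr ⟨hSp, hSq⟩, ENNReal.mul_ne_top
      ENNReal.ofReal_ne_top (ENNReal.mul_ne_top ENNReal.ofReal_ne_top hf2)⟩, fun m hm hmc ↦ ?_⟩
  have hmw := measurable_enorm_windowed_left hf
  have hV := measurable_enorm_stft hf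
  set A : ℝ → ℝ≥0∞ := fun x ↦ ∫⁻ ξ, ENNReal.ofReal (ξ ^ 2) * ‖stft f x ξ‖ₑ ^ 2 with hA
  set Bp : ℝ → ℝ≥0∞ := fun x ↦ ∑' n, bdryTerm ρ₂ ρ p (windowed f x) n with hBp
  set Bq : ℝ → ℝ≥0∞ := fun x ↦ ∑' n, bdryTerm ρ₂ ρ q (fun y ↦ windowed f x (-y)) n with hBq
  set D : ℝ → ℝ≥0∞ := fun x ↦ ∫⁻ y in Set.Icc (-R) R, ‖windowed f x y‖ₑ ^ 2 with hD
  have hBpm : Measurable Bp := Measurable.tsum fun n ↦ by unfold bdryTerm; fun_prop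
  have hBqm : Measurable Bq := Measurable.tsum fun n ↦ by unfold bdryTerm; fun_prop
  have hDm : Measurable D := (measurable_enorm_windowed hf).lintegral_prod_right'
  have hpt : ∀ x, m x * ∫⁻ y, ENNReal.ofReal (y ^ 2) * ‖windowed f x y‖ₑ ^ 2 ≤
      ENNReal.ofReal (ρ ^ 2) * (m x * A x) + (m x * Bp x + m x * Bq x) +
        ENNReal.ofReal (R ^ 2) * (m x * D x) := by
    intro x
    have := wirtinger_of_continuous (continuous_windowed_right hf x) (integrable_windowed hf hi x)
      (memLp_windowed hf h2 x) h0 hρ hp hq (tendsto_chain hp hδ hpδ) (tendsto_chain hq hδ' hqδ)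
      (le_max_left (p 0) (q 0)) (le_max_right (p 0) (q 0))
    calc _ ≤ m x * (ENNReal.ofReal (ρ ^ 2) * A x + (Bp x + Bq x) +
          ENNReal.ofReal (R ^ 2) * D x) := by
          gcongr
          simpa only [hA, hBp, hBq, hD, stft] using this
      _ = _ := by ring
  have hIA : ∫⁻ x, m x * A x = freqEnergy m f := by
    refine lintegral_congr fun x ↦ ?_
    have := measurable_enorm_stft_right hf x
    rw [hA, ← lintegral_const_mul _ (by fun_prop)]
    exact lintegral_congr fun ξ ↦ by ring
  have hIp : ∫⁻ x, m x * Bp x ≤ S p :=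
    lintegral_weight_bdry_le hm ha.le hc hc0 hca hmc hf hp.pos (fun n ↦ (hp.lt_succ n).le)
      (fun n ↦ rfl) hfp
  have hIq : ∫⁻ x, m x * Bq x ≤ S q :=
    lintegral_weight_bdry_le (r := fun n ↦ -q n) hm ha.le hc hc0 hca hmc hf hq.pos
      (fun n ↦ (hq.lt_succ n).le) (fun n ↦ neg_sq _) hfq
  have hID : ∫⁻ x, m x * D x ≤
      ENNReal.ofReal (Real.exp (2 * c * R ^ 2)) * ∫⁻ y, ‖f y‖ₑ ^ 2 := by
    have h1 : ∀ x, m x * D x = ∫⁻ y in Set.Icc (-R) R, m x * ‖windowed f x y‖ₑ ^ 2 := fun x ↦ by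
      rw [hD, lintegral_const_mul _ (measurable_enorm_windowed_right hf x)]
    have hmm : Measurable fun z : ℝ × ℝ ↦ m z.1 * ‖windowed f z.1 z.2‖ₑ ^ 2 := by
      have := measurable_enorm_windowed hf
      fun_prop
    simp only [h1]
    rw [lintegral_lintegral_swap hmm.aemeasurable, ← lintegral_const_mul' _ _ ENNReal.ofReal_ne_top]
    refine le_trans ?_ (setLIntegral_le_lintegral (Set.Icc (-R) R) _)
    refine setLIntegral_mono' measurableSet_Icc fun y hy ↦ ?_
    refine (lintegral_weight_windowed_le hc hmc hc0 f y).trans ?_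
    have hyR : y ^ 2 ≤ R ^ 2 := sq_le_sq' hy.1 hy.2
    gcongr
  refine (lintegral_mono hpt).trans ?_
  rw [lintegral_add_right _ (by fun_prop), lintegral_add_right _ (by fun_prop),
    lintegral_add_right _ (by fun_prop), lintegral_const_mul' _ _ ENNReal.ofReal_ne_top,
    lintegral_const_mul' _ _ ENNReal.ofReal_ne_top, hIA, add_assoc]
  gcongr

theorem localEnergy_le_of_gapLimsup {θ ρ a c C : ℝ} (hθ : 2 * θ < ρ) (hρ0 : 0 < ρ) (hρ1 : ρ ≤ 1)
    (ha : 0 < a) (hc : 2 * c ≤ Real.pi) (hc0 : 0 ≤ c) (hca : 2 * c ≤ a) {s : ℤ → ℝ}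
    (hst : Tendsto s atTop atTop) (hsb : Tendsto s atBot atBot) (hs : gapLimsup s ≤ (θ : EReal))
    {f : ℝ → ℂ} (hf : Continuous f) (hi : Integrable f) (h2 : MemLp f 2 volume)
    (hfs : ∀ i, ‖f (s i)‖ ≤ C * Real.exp (-a * |s i| ^ 2)) :
    ∃ B : ℝ≥0∞, B ≠ ∞ ∧ ∀ m : ℝ → ℝ≥0∞, Measurable m →
      (∀ x, m x ≤ ENNReal.ofReal (Real.exp (c * x ^ 2))) →
      localEnergy m f ≤ ENNReal.ofReal (ρ ^ 2) * freqEnergy m f + B := by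
  obtain ⟨ρ₀, hρ₀, hρ₀ρ⟩ := exists_between (max_lt hθ hρ0)
  obtain ⟨ρ₂, hρ₂, hρ₂ρ⟩ := exists_between hρ₀ρ
  have hρ₀0 : 0 < ρ₀ := (le_max_right _ _).trans_lt hρ₀
  have habs : Tendsto (fun i ↦ |s i|) (atBot ⊔ atTop) atTop :=
    (tendsto_abs_atBot_atTop.comp hsb).sup (tendsto_abs_atTop_atTop.comp hst)
  have hev := eventually_sq_step_le habs hρ₀0 ((le_max_left _ _).trans_lt hρ₀) hs
  rw [eventually_sup] at hev
  obtain ⟨p, δ, hδ, hp, hps, hpδ⟩ := exists_chain (s := fun n : ℕ ↦ s n)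
    (hst.comp tendsto_natCast_atTop_atTop) hρ₀0 hρ₂ (hρ₂ρ.le.trans hρ1)
    (by simpa using tendsto_natCast_atTop_atTop.eventually hev.2)
  have hneg : Tendsto (fun n : ℕ ↦ -(n : ℤ)) atTop atBot :=
    tendsto_neg_atTop_atBot.comp tendsto_natCast_atTop_atTop
  have hneg' : Tendsto (fun n : ℕ ↦ -(n : ℤ) - 1) atTop atBot :=
    tendsto_atBot_add_const_right _ (-1) hneg
  obtain ⟨q, δ', hδ', hq, hqs, hqδ⟩ := exists_chain (s := fun n : ℕ ↦ -s (-(n : ℤ)))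
    (tendsto_neg_atBot_atTop.comp (hsb.comp hneg)) hρ₀0 hρ₂ (hρ₂ρ.le.trans hρ1) (by
      filter_upwards [hneg'.eventually hev.1] with n hn
      have e : -((n + 1 : ℕ) : ℤ) = -(n : ℤ) - 1 := by push_cast; ring
      rw [e, neg_sq, neg_sq, abs_sub_comm]
      simpa using hn)
  refine localEnergy_le_of_chain (C := C) (hρ₀0.trans hρ₂) hρ₂ρ (hρ₂ρ.le.trans hρ1) ha hc hc0 hca
    hp hq hδ hδ' hpδ hqδ hf hi h2 (fun n ↦ ?_) (fun n ↦ ?_)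
  · obtain ⟨k, hk⟩ := hps n
    rw [hk]; exact hfs k
  · obtain ⟨k, hk⟩ := hqs n
    rw [hk, neg_neg]; exact hfs _

theorem ENNReal.le_of_le_mul_self_add {κ : ℝ} (h0 : 0 ≤ κ) (h1 : κ < 1) {P E : ℝ≥0∞} (hP : P ≠ ∞)
    (h : P ≤ ENNReal.ofReal κ * P + E) : P ≤ ENNReal.ofReal (1 / (1 - κ)) * E := by
  by_cases hE : E = ∞
  · have : 0 < 1 / (1 - κ) := by have : 0 < 1 - κ := by linarith
                                 positivity
    rw [hE, ENNReal.mul_top (by simpa using this)]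
    exact le_top
  lift P to NNReal using hP
  lift E to NNReal using hE
  have h2 : (P : ℝ) ≤ κ * P + E := by
    have := ENNReal.toReal_mono (by finiteness) h
    rw [ENNReal.toReal_add (by finiteness) (by finiteness), ENNReal.toReal_mul,
      ENNReal.toReal_ofReal h0] at this
    exact this
  have h3 : (P : ℝ) ≤ 1 / (1 - κ) * E := by
    rw [div_mul_eq_mul_div, one_mul, le_div_iff₀ (by linarith)]; linarith
  have h4 := ENNReal.ofReal_le_ofReal h3
  rwa [ENNReal.ofReal_mul (by apply div_nonneg <;> linarith), ENNReal.ofReal_coe_nnreal,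
    ENNReal.ofReal_coe_nnreal] at h4

/-- A pointwise bound by the energies: `‖f y‖` is controlled by the Sobolev norm of the windowed
functions with centre `x` in an interval of length one where `m x ≥ m y`. -/
theorem weight_mul_le {m : ℝ → ℝ≥0∞} (hm : Measurable m) (hmono : ∀ x y, |x| ≤ |y| → m x ≤ m y)
    {f : ℝ → ℂ} (hf : Continuous f) (hi : Integrable f) (h2 : MemLp f 2 volume) (y : ℝ) :
    m y * ‖f y‖ₑ ^ 2 ≤ ENNReal.ofReal (Real.exp (2 * Real.pi)) * (ENNReal.ofReal Real.pi *
      (m 1 * (∫⁻ t, ‖f t‖ₑ ^ 2) + posEnergy m f + freqEnergy m f)) := by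
  have hV := measurable_enorm_stft hf
  have hVx := measurable_enorm_stft_right hf
  have hupper : ∫⁻ x, m x * ‖windowed f x y‖ₑ ^ 2 ≤ ENNReal.ofReal Real.pi *
      (m 1 * (∫⁻ t, ‖f t‖ₑ ^ 2) + posEnergy m f + freqEnergy m f) := by
    have hpt : ∀ x, m x * ‖windowed f x y‖ₑ ^ 2 ≤ ENNReal.ofReal Real.pi *
        (m 1 * (∫⁻ t, ‖windowed f x t‖ₑ ^ 2) +
          (∫⁻ ξ, ENNReal.ofReal (x ^ 2) * m x * ‖stft f x ξ‖ₑ ^ 2) +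
          ∫⁻ ξ, ENNReal.ofReal (ξ ^ 2) * m x * ‖stft f x ξ‖ₑ ^ 2) := by
      intro x
      have h3 := enorm_sq_le_lintegral_fourier (continuous_windowed_right hf x)
        (integrable_windowed hf hi x) y
      have h4 : m x * ∫⁻ ξ, ‖stft f x ξ‖ₑ ^ 2 ≤ m 1 * (∫⁻ t, ‖windowed f x t‖ₑ ^ 2) +
          ∫⁻ ξ, ENNReal.ofReal (x ^ 2) * m x * ‖stft f x ξ‖ₑ ^ 2 := by
        rw [lintegral_const_mul _ (hVx x), ← lintegral_stft_sq hf hi h2, ← add_mul]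
        gcongr
        rcases le_total |x| 1 with h | h
        · exact le_add_right (hmono _ _ (by simpa using h))
        · refine le_add_left (le_mul_of_one_le_left' ?_)
          rw [ENNReal.one_le_ofReal]
          rwa [one_le_sq_iff_one_le_abs]
      have h5 : m x * ∫⁻ ξ, ENNReal.ofReal (ξ ^ 2) * ‖stft f x ξ‖ₑ ^ 2 =
          ∫⁻ ξ, ENNReal.ofReal (ξ ^ 2) * m x * ‖stft f x ξ‖ₑ ^ 2 := by
        have := hVx x
        rw [← lintegral_const_mul _ (by fun_prop)]
        exact lintegral_congr fun ξ ↦ by ring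
      rw [lintegral_weight_eq (continuous_fourier_of_integrable
        (integrable_windowed hf hi x)).aemeasurable] at h3
      calc m x * ‖windowed f x y‖ₑ ^ 2 ≤ m x * (ENNReal.ofReal Real.pi *
            ((∫⁻ ξ, ‖stft f x ξ‖ₑ ^ 2) + ∫⁻ ξ, ENNReal.ofReal (ξ ^ 2) * ‖stft f x ξ‖ₑ ^ 2)) := by
            gcongr
            simpa only [stft] using h3
        _ = ENNReal.ofReal Real.pi * (m x * (∫⁻ ξ, ‖stft f x ξ‖ₑ ^ 2) +
            m x * ∫⁻ ξ, ENNReal.ofReal (ξ ^ 2) * ‖stft f x ξ‖ₑ ^ 2) := by ring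
        _ ≤ _ := by rw [h5]; gcongr
    have hx : Measurable fun z : ℝ × ℝ ↦ ENNReal.ofReal (z.1 ^ 2) := by fun_prop
    have hm2 : Measurable fun z : ℝ × ℝ ↦
        ENNReal.ofReal (z.1 ^ 2) * m z.1 * ‖stft f z.1 z.2‖ₑ ^ 2 := by fun_prop
    have hm3 : Measurable fun z : ℝ × ℝ ↦
        ENNReal.ofReal (z.2 ^ 2) * m z.1 * ‖stft f z.1 z.2‖ₑ ^ 2 := by fun_prop
    refine (lintegral_mono hpt).trans ?_
    rw [lintegral_const_mul' _ _ ENNReal.ofReal_ne_top,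
      lintegral_add_right _ hm3.lintegral_prod_right',
      lintegral_add_right _ hm2.lintegral_prod_right',
      lintegral_const_mul _ (measurable_enorm_windowed hf).lintegral_prod_right']
    exact mul_le_mul_right (add_le_add (add_le_add
      (mul_le_mul_right (lintegral_windowed_sq_le hf) _) le_rfl) le_rfl) _
  -- an interval of length one next to `y`, on the side away from the origin
  obtain ⟨b, hbx⟩ : ∃ b : ℝ, ∀ x ∈ Set.Icc b (b + 1), |y| ≤ |x| ∧ |y - x| ≤ 1 := by
    rcases le_total 0 y with h | h
    · refine ⟨y, fun x hx ↦ ⟨?_, ?_⟩⟩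
      · rw [abs_of_nonneg h, abs_of_nonneg (h.trans hx.1)]; exact hx.1
      · rw [abs_le]; constructor <;> linarith [hx.1, hx.2]
    · refine ⟨y - 1, fun x hx ↦ ⟨?_, ?_⟩⟩
      · have : x ≤ y := by linarith [hx.2]
        rw [abs_of_nonpos h, abs_of_nonpos (this.trans h)]; linarith
      · rw [abs_le]; constructor <;> linarith [hx.1, hx.2]
  have hlower : m y * ‖f y‖ₑ ^ 2 * ENNReal.ofReal (Real.exp (-(2 * Real.pi))) ≤
      ∫⁻ x, m x * ‖windowed f x y‖ₑ ^ 2 := by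
    calc _ = ∫⁻ _ in Set.Icc b (b + 1),
          m y * ‖f y‖ₑ ^ 2 * ENNReal.ofReal (Real.exp (-(2 * Real.pi))) := by
          rw [setLIntegral_const, Real.volume_Icc]; simp
      _ ≤ ∫⁻ x in Set.Icc b (b + 1), m x * ‖windowed f x y‖ₑ ^ 2 := by
          refine setLIntegral_mono' measurableSet_Icc fun x hx ↦ ?_
          obtain ⟨hx1, hx2⟩ := hbx x hx
          rw [enorm_windowed_sq, ← mul_assoc]
          have h3 : (y - x) ^ 2 ≤ 1 := by rwa [sq_le_one_iff_abs_le_one]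
          gcongr
          · exact hmono _ _ hx1
          · nlinarith [Real.pi_pos]
      _ ≤ _ := setLIntegral_le_lintegral _ _
  calc m y * ‖f y‖ₑ ^ 2 = ENNReal.ofReal (Real.exp (2 * Real.pi)) *
        (m y * ‖f y‖ₑ ^ 2 * ENNReal.ofReal (Real.exp (-(2 * Real.pi)))) := by
        rw [mul_left_comm, ← ENNReal.ofReal_mul (by positivity), ← Real.exp_add]
        simp
    _ ≤ _ := mul_le_mul_right (hlower.trans hupper) _

/-- A Gaussian weight truncated at height `N`. -/
noncomputable def truncWeight (c : ℝ) (N : ℕ) (x : ℝ) : ℝ≥0∞ :=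
  min (ENNReal.ofReal (Real.exp (c * x ^ 2))) N

theorem measurable_truncWeight (c : ℝ) (N : ℕ) : Measurable (truncWeight c N) := by
  unfold truncWeight; fun_prop

theorem truncWeight_mono {c : ℝ} (hc : 0 ≤ c) (N : ℕ) (x y : ℝ) (h : |x| ≤ |y|) :
    truncWeight c N x ≤ truncWeight c N y := by
  have := sq_le_sq.mpr h
  unfold truncWeight
  gcongr

theorem norm_le_of_forall_truncWeight {c : ℝ} {Y : ℝ≥0∞} (hY : Y ≠ ∞) {f : ℝ → ℂ}
    (h : ∀ N y, truncWeight c N y * ‖f y‖ₑ ^ 2 ≤ Y) (y : ℝ) :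
    ‖f y‖ ≤ Real.sqrt Y.toReal * Real.exp (-(c / 2) * |y| ^ 2) := by
  obtain ⟨N, hN⟩ := exists_nat_ge (Real.exp (c * y ^ 2))
  have h1 := h N y
  have h2 : truncWeight c N y = ENNReal.ofReal (Real.exp (c * y ^ 2)) := by
    rw [truncWeight, min_eq_left]
    rw [← ENNReal.ofReal_natCast]
    exact ENNReal.ofReal_le_ofReal hN
  rw [h2, ← ofReal_norm, ← ENNReal.ofReal_pow (norm_nonneg _),
    ← ENNReal.ofReal_mul (Real.exp_pos _).le, ENNReal.ofReal_le_iff_le_toReal hY] at h1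
  refine le_of_sq_le_sq ?_ (by positivity)
  rw [mul_pow, Real.sq_sqrt ENNReal.toReal_nonneg, ← Real.exp_nat_mul, sq_abs]
  have h3 : ((2 : ℕ) : ℝ) * (-(c / 2) * y ^ 2) = -(c * y ^ 2) := by push_cast; ring
  rw [h3, Real.exp_neg, ← div_eq_mul_inv, le_div_iff₀ (Real.exp_pos _)]
  linarith

/-- The energy estimates close up: local energy is bounded by frequency energy, frequency energy by
position energy, position energy by local energy, with total factor `ρ² (1 + η)² < 1`. The local
energy is finite because the weight is truncated, and the bound does not depend on the height. -/
theorem exists_gaussian_bound {f : ℝ → ℂ} (hf : Continuous f) (hi : Integrable f)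
    (hwf : ∫⁻ x, ENNReal.ofReal (1 + x ^ 2) * ‖f x‖ₑ ^ 2 ≠ ∞)
    (hwF : ∫⁻ ξ, ENNReal.ofReal (1 + ξ ^ 2) * ‖𝓕 f ξ‖ₑ ^ 2 ≠ ∞) {ρ η c : ℝ} (hρ : 0 < ρ)
    (hη : 0 < η) (hρη : ρ ^ 2 * (1 + η) ^ 2 < 1) (hc : 0 ≤ c)
    (hcη : c * (1 + 1 / η) ^ 2 ≤ Real.pi)
    (h1 : ∃ B : ℝ≥0∞, B ≠ ∞ ∧ ∀ m : ℝ → ℝ≥0∞, Measurable m →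
      (∀ x, m x ≤ ENNReal.ofReal (Real.exp (c * x ^ 2))) →
      localEnergy m f ≤ ENNReal.ofReal (ρ ^ 2) * freqEnergy m f + B)
    (h2 : ∃ B : ℝ≥0∞, B ≠ ∞ ∧ ∀ m : ℝ → ℝ≥0∞, Measurable m →
      (∀ x, m x ≤ ENNReal.ofReal (Real.exp (c * x ^ 2))) →
      localEnergy m (𝓕 f) ≤ ENNReal.ofReal (ρ ^ 2) * freqEnergy m (𝓕 f) + B) :
    ∃ C', ∀ x, ‖f x‖ + ‖𝓕 f x‖ ≤ C' * Real.exp (-(c / 2) * |x| ^ 2) := by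
  obtain ⟨B₁, hB₁, h1⟩ := h1
  obtain ⟨B₂, hB₂, h2⟩ := h2
  have hF := continuous_fourier_of_integrable hi
  have hFi := integrable_of_lintegral_weight hF.aestronglyMeasurable hwF
  have hL2 : ∀ {u : ℝ → ℂ}, Continuous u →
      ∫⁻ x, ENNReal.ofReal (1 + x ^ 2) * ‖u x‖ₑ ^ 2 ≠ ∞ → ∫⁻ x, ‖u x‖ₑ ^ 2 ≠ ∞ := by
    intro u hu hw
    rw [lintegral_weight_eq hu.measurable.aemeasurable] at hw
    exact (ENNReal.add_ne_top.mp hw).1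
  have hmem : ∀ {u : ℝ → ℂ}, Continuous u → ∫⁻ x, ‖u x‖ₑ ^ 2 ≠ ∞ → MemLp u 2 volume :=
    fun hu hw ↦ (memLp_two_iff hu.aestronglyMeasurable).mpr hw
  have hf2 := hmem hf (hL2 hf hwf)
  have hF2 := hmem hF (hL2 hF hwF)
  set κ : ℝ := ρ ^ 2 * (1 + η) ^ 2 with hκ
  set k : ℝ≥0∞ := ENNReal.ofReal ((1 + 1 / η) ^ 2) with hk
  set G : ℝ≥0∞ := ∫⁻ z : ℝ, ENNReal.ofReal (z ^ 2 * Real.exp (-Real.pi * z ^ 2)) with hG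
  have hGt : G ≠ ∞ := lintegral_gaussian_moment_ne_top
  set E : ℝ≥0∞ := k * (G * ∫⁻ y, ‖f y‖ₑ ^ 2) + k * (G * ∫⁻ y, ‖𝓕 f y‖ₑ ^ 2) with hE
  have hEt : E ≠ ∞ := ENNReal.add_ne_top.mpr
    ⟨ENNReal.mul_ne_top ENNReal.ofReal_ne_top (ENNReal.mul_ne_top hGt (hL2 hf hwf)),
      ENNReal.mul_ne_top ENNReal.ofReal_ne_top (ENNReal.mul_ne_top hGt (hL2 hF hwF))⟩
  set L : ℝ≥0∞ := ENNReal.ofReal (1 / (1 - κ)) *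
    (ENNReal.ofReal (ρ ^ 2) * E + (B₁ + B₂)) with hL
  have hLt : L ≠ ∞ := ENNReal.mul_ne_top ENNReal.ofReal_ne_top (ENNReal.add_ne_top.mpr
    ⟨ENNReal.mul_ne_top ENNReal.ofReal_ne_top hEt, ENNReal.add_ne_top.mpr ⟨hB₁, hB₂⟩⟩)
  set Z : ℝ≥0∞ := ENNReal.ofReal ((1 + η) ^ 2) * L + E with hZ
  -- bounds uniform in the truncation height
  have hunif : ∀ N : ℕ, posEnergy (truncWeight c N) f + posEnergy (truncWeight c N) (𝓕 f) ≤ Z := by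
    intro N
    set m := truncWeight c N
    have hm := measurable_truncWeight c N
    have hmc : ∀ x, m x ≤ ENNReal.ofReal (Real.exp (c * x ^ 2)) := fun x ↦ min_le_left _ _
    have hmN : ∀ x, m x ≤ (N : ℝ≥0∞) := fun x ↦ min_le_right _ _
    have hNt : (N : ℝ≥0∞) ≠ ∞ := ENNReal.natCast_ne_top N
    have hT : posEnergy m f + posEnergy m (𝓕 f) ≤ ENNReal.ofReal ((1 + η) ^ 2) *
        (localEnergy m f + localEnergy m (𝓕 f)) + E := by
      refine (add_le_add (posEnergy_le hc hη hcη hmc hf hi hf2)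
        (posEnergy_le hc hη hcη hmc hF hFi hF2)).trans (le_of_eq ?_)
      rw [hE]; ring
    have hQ := freqEnergy_add_le hm (truncWeight_mono hc N) hf hi
    have hP : localEnergy m f + localEnergy m (𝓕 f) ≤ L := by
      refine ENNReal.le_of_le_mul_self_add (by positivity) hρη (ENNReal.add_ne_top.mpr
        ⟨localEnergy_ne_top hNt hmN hf hwf, localEnergy_ne_top hNt hmN hF hwF⟩) ?_
      calc _ ≤ (ENNReal.ofReal (ρ ^ 2) * freqEnergy m f + B₁) +
            (ENNReal.ofReal (ρ ^ 2) * freqEnergy m (𝓕 f) + B₂) :=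
            add_le_add (h1 m hm hmc) (h2 m hm hmc)
        _ = ENNReal.ofReal (ρ ^ 2) * (freqEnergy m f + freqEnergy m (𝓕 f)) + (B₁ + B₂) := by ring
        _ ≤ ENNReal.ofReal (ρ ^ 2) * (ENNReal.ofReal ((1 + η) ^ 2) *
            (localEnergy m f + localEnergy m (𝓕 f)) + E) + (B₁ + B₂) := by
            exact add_le_add (mul_le_mul_right (hQ.trans hT) _) le_rfl
        _ = _ := by rw [hκ, ENNReal.ofReal_mul (by positivity)]; ring
    exact hT.trans (by rw [hZ]; gcongr)
  have hfinal : ∀ {u : ℝ → ℂ}, Continuous u → Integrable u → ∫⁻ x, ‖u x‖ₑ ^ 2 ≠ ∞ →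
      (∀ N : ℕ, posEnergy (truncWeight c N) u ≤ Z ∧ freqEnergy (truncWeight c N) u ≤ Z) →
      ∃ K, ∀ x, ‖u x‖ ≤ K * Real.exp (-(c / 2) * |x| ^ 2) := by
    intro u hu hui hu2 hbd
    refine ⟨_, norm_le_of_forall_truncWeight (Y := ENNReal.ofReal (Real.exp (2 * Real.pi)) *
      (ENNReal.ofReal Real.pi * (ENNReal.ofReal (Real.exp (c * 1 ^ 2)) * (∫⁻ t, ‖u t‖ₑ ^ 2) +
        Z + Z))) (by finiteness) fun N y ↦ ?_⟩
    refine (weight_mul_le (measurable_truncWeight c N) (truncWeight_mono hc N) hu hui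
      (hmem hu hu2) y).trans ?_
    gcongr
    · exact min_le_left _ _
    · exact (hbd N).1
    · exact (hbd N).2
  have hQZ : ∀ N : ℕ, freqEnergy (truncWeight c N) f + freqEnergy (truncWeight c N) (𝓕 f) ≤ Z :=
    fun N ↦ (freqEnergy_add_le (measurable_truncWeight c N) (truncWeight_mono hc N) hf hi).trans
      (hunif N)
  obtain ⟨K₁, hK₁⟩ := hfinal hf hi (hL2 hf hwf) fun N ↦
    ⟨le_self_add.trans (hunif N), le_self_add.trans (hQZ N)⟩
  obtain ⟨K₂, hK₂⟩ := hfinal hF hFi (hL2 hF hwF) fun N ↦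
    ⟨le_add_self.trans (hunif N), le_add_self.trans (hQZ N)⟩
  refine ⟨K₁ + K₂, fun x ↦ ?_⟩
  rw [add_mul]
  exact add_le_add (hK₁ x) (hK₂ x)

theorem mainTheorem3 (a : ℝ) (ha : 0 < a) (θ : ℝ) (hθ : θ < 1 / 2) :
    ∃ c : ℝ, 0 < c ∧
      ∀ Λ Γ : ℤ → ℝ,
        Tendsto Λ atTop atTop → Tendsto Λ atBot atBot →
        Tendsto Γ atTop atTop → Tendsto Γ atBot atBot →
        max (gapLimsup Λ) (gapLimsup Γ) ≤ (θ : EReal) →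
        ∀ f : ℝ → ℂ, Continuous f → MemH1 f → MemFourierH1 f →
          ∀ C : ℝ,
            (∀ i : ℤ, ‖f (Λ i)‖ ≤ C * Real.exp (-a * |Λ i| ^ 2)) →
            (∀ i : ℤ, ‖𝓕 f (Γ i)‖ ≤ C * Real.exp (-a * |Γ i| ^ 2)) →
            ∃ C' : ℝ, ∀ x : ℝ, ‖f x‖ + ‖𝓕 f x‖ ≤ C' * Real.exp (-c * |x| ^ 2) := by
  -- `ρ` is a Wirtinger constant with `2θ < ρ < 1`, and `η` is the room left by `ρ < 1`
  obtain ⟨ρ, hρ, hρ1⟩ := exists_between (max_lt (show 2 * θ < 1 by linarith) zero_lt_one)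
  have hρ0 : 0 < ρ := (le_max_right _ _).trans_lt hρ
  have hθρ : 2 * θ < ρ := (le_max_left _ _).trans_lt hρ
  set η : ℝ := (1 - ρ) / 2 with hη
  have hη0 : 0 < η := by rw [hη]; linarith
  have hρη : ρ ^ 2 * (1 + η) ^ 2 < 1 := by
    rw [← mul_pow, sq_lt_one_iff_abs_lt_one, abs_of_pos (by positivity), hη]
    nlinarith
  set c : ℝ := min (Real.pi / (1 + 1 / η) ^ 2) (min (Real.pi / 2) (a / 2)) with hc
  have hc0 : 0 < c := lt_min (by positivity) (lt_min (by positivity) (by positivity))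
  have hc1 : c * (1 + 1 / η) ^ 2 ≤ Real.pi := by
    rw [← le_div_iff₀ (by positivity)]; exact min_le_left _ _
  have hc2 : 2 * c ≤ Real.pi := by
    have : c ≤ Real.pi / 2 := (min_le_right _ _).trans (min_le_left _ _)
    linarith
  have hc3 : 2 * c ≤ a := by
    have : c ≤ a / 2 := (min_le_right _ _).trans (min_le_right _ _)
    linarith
  refine ⟨c / 2, by positivity, fun Λ Γ hΛt hΛb hΓt hΓb hgap f hf hH hFH C hfΛ hfΓ ↦ ?_⟩
  have hwf := hFH.lintegral_ne_top
  have hi := integrable_of_lintegral_weight hf.aestronglyMeasurable hwf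
  have hwF := hH.lintegral_fourier_ne_top hi
  have hF := continuous_fourier_of_integrable hi
  have hFi := integrable_of_lintegral_weight hF.aestronglyMeasurable hwF
  have hf2 : MemLp f 2 volume := hH.1
  have hF2 : MemLp (𝓕 f) 2 volume := (Lp.memLp _).ae_eq (fourier_toLp_ae_eq hi hf2)
  exact exists_gaussian_bound hf hi hwf hwF hρ0 hη0 hρη hc0.le hc1
    (localEnergy_le_of_gapLimsup hθρ hρ0 hρ1.le ha hc2 hc0.le hc3 hΛt hΛb
      ((le_max_left _ _).trans hgap) hf hi hf2 hfΛ)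
    (localEnergy_le_of_gapLimsup hθρ hρ0 hρ1.le ha hc2 hc0.le hc3 hΓt hΓb
      ((le_max_right _ _).trans hgap) hF hFi hF2 hfΓ)
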